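/- Let $f=f^{(0)}+\cdots+f^{(m)}$ be a polynomial vector field on $\mathbb C^n$, with $f^{(j)}$ homogeneous of degree $j$ and $f^{(m)}\neq 0$. For $v\in\mathbb C^n\setminus\{0\}$ and an invertible matrix $T$ with $Tv=e_1$, put $h=T\circ f\circ T^{-1}$ and let $g_i(x_1,\dots,x_{n+1})=\sum_{j=0}^m h_i^{(j)}(x_1,\dots,x_n)\,x_{n+1}^{m-j}$ for $1\le i\le n$, $g_{n+1}=0$. The Poincaré transform of $f$ with respect to $v$ (and $T$) is the vector field $f_v^*$ on $\mathbb C^n$, in the variables $x_2,\dots,x_{n+1}$, with components $-g_1x_i+g_i$ ($2\le i\le n+1$), evaluated at $x_1=1$. A stationary point at infinity of $f$ is a zero of some $f_v^*$ lying in $\{x_{n+1}=0\}$. The vector field $f$ has property E if at every stationary point at infinity the eigenvalues $\lambda_1,\dots,\lambda_n$ (with multiplicity) of the Jacobian of $f_v^*$ satisfy one of the following conditions: 1. $\lambda_1,\dots,\lambda_n$ are linearly independent over $\mathbb Q$; 2. $\dim_{\mathbb Q}(\mathbb Q\lambda_1+\cdots+\mathbb Q\lambda_n)=n-1$, and $\sum_i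 m_i\lambda_i=0$ for some positive integers $m_1,\dots,m_n$. An idempotent of a homogeneous quadratic vector field $p$ on $\mathbb C^3$ is a $v\ne0$ with $p(v)=v$. Given $\gamma=(\gamma_{ij})_{1\le i,j\le 3}\in\mathbb C^{9}$, call $p$ distinguished with parameters $\gamma$ if $e_1,e_2,e_3$ and $v_i=\gamma_{i1}e_1+\gamma_{i2}e_2+\gamma_{i3}e_3$ ($i=1,2,3$) are idempotents of $p$ and the $3\times3$ matrix with rows $(\gamma_{i1}\gamma_{i2},\ \gamma_{i2}\gamma_{i3},\ \gamma_{i3}\gamma_{i1})$, $i=1,2,3$, is invertible. (a) If the nine numbers $\gamma_{ij}$ are algebraically independent over $\mathbb Q$, then there is exactly one distinguished homogeneous quadratic vector field on $\mathbb C^3$ with parameters $\gamma$, and it has property E. (b) Identify the homogeneous quadratic vector fields $$p(x)=\Bigl(\sum_{1\le i\le j\le 3}\beta_{i,j,k}\,x_ix_j\Bigr)_{1\le k\le 3}$$ with their coefficients $(\beta_{i,j,k})\in\mathbb C^{18}$. Then those which have property E form the complement of a set of Lebesgue measure zero in $\mathbb C^{18}$. -/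

import Mathlib

/-! Polynomial vector fields on `ℂ^(n+1)`, with coordinates `x 0, …, x n`, are tuples of
polynomials `f : Fin (n + 1) → MvPolynomial (Fin (n + 1)) ℂ`. -/

noncomputable section

/-- The degree of a polynomial vector field: the largest total degree of its components. -/
def vfDegree {n : ℕ} (f : Fin (n + 1) → MvPolynomial (Fin (n + 1)) ℂ) : ℕ :=
  Finset.univ.sup fun i => (f i).totalDegree

/-- The linear conjugate `T ∘ f ∘ T⁻¹` of a polynomial vector field. -/
def vfConj {n : ℕ} (T : Matrix.GeneralLinearGroup (Fin (n + 1)) ℂ)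
    (f : Fin (n + 1) → MvPolynomial (Fin (n + 1)) ℂ) :
    Fin (n + 1) → MvPolynomial (Fin (n + 1)) ℂ := fun i =>
  ∑ j, MvPolynomial.C (T.val i j) *
    MvPolynomial.aeval (fun k => ∑ l, MvPolynomial.C ((T⁻¹).val k l) * MvPolynomial.X l) (f j)

/-- The homogenization (in degree `m`) of a vector field with respect to one additional, last
variable; the additional last component is `0`. -/
def vfHomogenize {n : ℕ} (m : ℕ) (f : Fin (n + 1) → MvPolynomial (Fin (n + 1)) ℂ) :
    Fin (n + 2) → MvPolynomial (Fin (n + 2)) ℂ :=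
  Fin.snoc (α := fun _ => MvPolynomial (Fin (n + 2)) ℂ)
    (fun i => ∑ j ∈ Finset.range (m + 1),
      MvPolynomial.rename Fin.castSucc (MvPolynomial.homogeneousComponent j (f i)) *
        MvPolynomial.X (Fin.last (n + 1)) ^ (m - j))
    0

/-- The projection `-g₀(x) • x + x₀ • g(x)` with respect to the first variable. -/
def vfProject {n : ℕ} (g : Fin (n + 2) → MvPolynomial (Fin (n + 2)) ℂ) :
    Fin (n + 2) → MvPolynomial (Fin (n + 2)) ℂ := fun i =>
  -g 0 * MvPolynomial.X i + MvPolynomial.X 0 * g i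

/-- The special Poincaré transform (in degree `m`) with respect to the first standard basis
vector: the first variable of the projected homogenization is set equal to `1`, and the first
component, which is zero, is dropped.  The `n + 1` remaining variables and components are
indexed by `Fin (n + 1)`; the last one belongs to the homogenizing variable. -/
def poincareTransform {n : ℕ} (m : ℕ) (f : Fin (n + 1) → MvPolynomial (Fin (n + 1)) ℂ) :
    Fin (n + 1) → MvPolynomial (Fin (n + 1)) ℂ := fun k =>
  MvPolynomial.aeval
    (Fin.cons (α := fun _ => MvPolynomial (Fin (n + 1)) ℂ) 1 MvPolynomial.X)
    (vfProject (vfHomogenize m f) k.succ)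

/-- The Jacobian matrix of a polynomial vector field at a point. -/
def vfJacobian {n : ℕ} (g : Fin (n + 1) → MvPolynomial (Fin (n + 1)) ℂ) (y : Fin (n + 1) → ℂ) :
    Matrix (Fin (n + 1)) (Fin (n + 1)) ℂ :=
  Matrix.of fun i j => MvPolynomial.eval y (MvPolynomial.pderiv j (g i))

/-- The first condition on eigenvalues: linear independence over `ℚ`. -/
def EigenCondOne {n : ℕ} (ev : Fin n → ℂ) : Prop :=
  LinearIndependent ℚ ev

/-- The second condition on eigenvalues: they span a `ℚ`-space of dimension `n - 1`, and satisfy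
a linear relation with positive integer coefficients. -/
def EigenCondTwo {n : ℕ} (ev : Fin n → ℂ) : Prop :=
  Module.finrank ℚ (Submodule.span ℚ (Set.range ev)) + 1 = n ∧
    ∃ c : Fin n → ℕ, (∀ i, 0 < c i) ∧ ∑ i, (c i : ℂ) * ev i = 0

/-- The eigenvalues of `B`, counted with multiplicity, satisfy one of the two conditions. (Both
conditions are invariant under permutations of the eigenvalues.) -/
def GoodLinearization {n : ℕ} (B : Matrix (Fin n) (Fin n) ℂ) : Prop :=
  ∃ ev : Fin n → ℂ, B.charpoly.roots = Multiset.map ev Finset.univ.val ∧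
    (EigenCondOne ev ∨ EigenCondTwo ev)

/-- Property E: for all Poincaré transforms of `f`, with respect to any `v ≠ 0` and any regular
`T` with `T v = e₁`, the linearization at every stationary point at infinity (that is, on the
hyperplane where the last variable vanishes) satisfies one of the two conditions. -/
def PropertyE {n : ℕ} (f : Fin (n + 1) → MvPolynomial (Fin (n + 1)) ℂ) : Prop :=
  ∀ v : Fin (n + 1) → ℂ, v ≠ 0 →
  ∀ T : Matrix.GeneralLinearGroup (Fin (n + 1)) ℂ, T.val.mulVec v = Pi.single 0 1 →
  ∀ y : Fin (n + 1) → ℂ, y (Fin.last n) = 0 →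
    (∀ k, MvPolynomial.eval y (poincareTransform (vfDegree f) (vfConj T f) k) = 0) →
    GoodLinearization (vfJacobian (poincareTransform (vfDegree f) (vfConj T f)) y)

/-- `v` is an idempotent of `p`: `p(v) = v ≠ 0`. -/
def IsIdempotentOf {n : ℕ} (p : Fin (n + 1) → MvPolynomial (Fin (n + 1)) ℂ)
    (v : Fin (n + 1) → ℂ) : Prop :=
  (∀ k, MvPolynomial.eval v (p k) = v k) ∧ v ≠ 0

/-- The matrix whose `i`-th row is `(γ i 0 * γ i 1, γ i 1 * γ i 2, γ i 2 * γ i 0)`. -/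
def distinguishedMatrix (γ : Fin 3 → Fin 3 → ℂ) : Matrix (Fin 3) (Fin 3) ℂ :=
  Matrix.of fun i j => γ i j * γ i (j + 1)

/-- `p` is a distinguished homogeneous quadratic vector field on `ℂ³` with parameters `γ`: the
standard basis vectors and the three vectors `γ i = (γ i 0, γ i 1, γ i 2)` are idempotents, and
the matrix formed from the products of the parameters is invertible. -/
structure IsDistinguished (γ : Fin 3 → Fin 3 → ℂ) (p : Fin 3 → MvPolynomial (Fin 3) ℂ) :
    Prop where
  homogeneous : ∀ k, (p k).IsHomogeneous 2
  basis_idempotent : ∀ i, IsIdempotentOf p (Pi.single i 1)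
  further_idempotent : ∀ i, IsIdempotentOf p (γ i)
  isUnit_matrix : IsUnit (distinguishedMatrix γ)

/-- The index set of the 18 coefficients of a homogeneous quadratic vector field on `ℂ³`: pairs
`i ≤ j` (standing for the monomial `x i * x j`) together with a component `k`. -/
abbrev QuadIndex : Type := {q : Fin 3 × Fin 3 // q.1 ≤ q.2} × Fin 3

/-- The homogeneous quadratic vector field with coefficients `β`. -/
def quadField (β : QuadIndex → ℂ) : Fin 3 → MvPolynomial (Fin 3) ℂ := fun k =>
  ∑ q : {q : Fin 3 × Fin 3 // q.1 ≤ q.2},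
    MvPolynomial.C (β (q, k)) * (MvPolynomial.X q.val.1 * MvPolynomial.X q.val.2)

end

/-! A stationary point at infinity of a homogeneous quadratic field `p` is an invariant line: a
vector w, normalised to (1, s, t), with p(w) = μ w. By Euler's identity w is an eigenvector of Dp(w)
for 2μ. If a, c are the other two eigenvalues, the Jacobian at infinity has eigenvalues -μ, a - μ, c
- μ (`roots_charpoly_of_block`, `propertyE_of_goodAt`). Only the first eigenvalue condition is ever
needed: it suffices that μ, a, c are linearly independent over ℚ.

This follows from a parameter count. The numbers μ, a, c, s, t are completed by entries of Dp(w) and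
coefficients of `p` to a list exactly as long as the list of free coefficients, from which all
coefficients can be recovered by field operations and the solution of one quadratic equation. If the
free coefficients are algebraically independent, comparison of transcendence degrees makes the new
list algebraically independent as well (`algebraicIndependent_of_generate`). With 18 free
coefficients this is `goodAt_of_generic`; part (b) follows because algebraically dependent tuples
form a null set. If the basis vectors are idempotents, nine free coefficients remain
(`goodAt_of_generic_of_basis_idempotent`); on the basis lines μ = 1, and independence of a, c is
enough.

For part (a), idempotency of the vectors `γ i` is a linear system M(γ) c = R(γ) for the nine mixed
coefficients c. It is uniquely solvable for generic γ. Algebraic independence passes from γ to c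
(`algebraicIndependent_mixed`) because γ ↦ c is locally invertible near a point with 0-1 coordinates
where M = 1 and R = 0. -/

open MvPolynomial MeasureTheory Filter Topology

/-! ### Transcendence degree counting -/

/-- A subfield containing the roots of all monic quadratic polynomials over it. -/
def QuadClosed (F : Subfield ℂ) : Prop :=
  ∀ u ∈ F, ∀ v ∈ F, ∀ z : ℂ, z * z + u * z + v = 0 → z ∈ F

/-- The relative algebraic closure in `ℂ` of the field generated by `s`. -/
noncomputable def algClosureField (s : Set ℂ) : Subfield ℂ where
  __ := (Subalgebra.algebraicClosure (Algebra.adjoin ℚ s) ℂ).toSubring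
  inv_mem' x hx := by
    have hx' : IsAlgebraic (Algebra.adjoin ℚ s) x := hx
    exact hx'.inv

theorem quadClosed_algClosureField (s : Set ℂ) : QuadClosed (algClosureField s) := by
  intro u hu v hv z hz
  let S := Subalgebra.algebraicClosure (Algebra.adjoin ℚ s) ℂ
  have : IsAlgebraic S z := by
    refine ⟨Polynomial.X * Polynomial.X + Polynomial.C (⟨u, hu⟩ : S) * Polynomial.X
      + Polynomial.C (⟨v, hv⟩ : S), ?_, ?_⟩
    · intro h
      have := congrArg (fun p => Polynomial.coeff p 2) h
      simp [Polynomial.coeff_X] at this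
    · simpa using hz
  exact this.restrictScalars (Algebra.adjoin ℚ s)

/-- Applied to the relative algebraic closure of ℚ(y), the hypothesis `h` puts x in the matroid
closure of y. The rank of y is then at least the number of its entries, so the entries are distinct
and independent. -/
theorem algebraicIndependent_of_generate {ι κ : Type*} [Fintype ι] [Fintype κ]
    {x : ι → ℂ} {y : κ → ℂ} (hx : AlgebraicIndependent ℚ x)
    (hcard : Fintype.card κ = Fintype.card ι)
    (h : ∀ F : Subfield ℂ, QuadClosed F → (∀ j, y j ∈ F) → ∀ i, x i ∈ F) :
    AlgebraicIndependent ℚ y := by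
  classical
  let M := AlgebraicIndependent.matroid ℚ ℂ
  have hind : M.Indep (Set.range x) := AlgebraicIndependent.matroid_indep_iff.2 hx.to_subtype_range
  have hsub : Set.range x ⊆ M.closure (Set.range y) := by
    rw [AlgebraicIndependent.matroid_closure_eq]
    rintro _ ⟨i, rfl⟩
    refine h (algClosureField (Set.range y)) (quadClosed_algClosureField _) (fun j => ?_) i
    exact isAlgebraic_algebraMap
      (⟨y j, Algebra.subset_adjoin (Set.mem_range_self j)⟩ : Algebra.adjoin ℚ (Set.range y))
  have h1 : (Set.range x).encard ≤ M.eRk (Set.range y) := by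
    rw [← M.eRk_closure_eq]
    exact hind.encard_le_eRk_of_subset hsub
  have h2 : (Set.range x).encard = Fintype.card ι := by
    rw [← Set.image_univ, hx.injective.encard_image, Set.encard_univ, ENat.card_eq_coe_fintype_card]
  have h3 : (Set.range y).encard = (Finset.univ.image y).card := by
    rw [← Set.encard_coe_eq_coe_finsetCard]; simp
  have h4 : (Finset.univ.image y).card = Fintype.card κ := by
    refine le_antisymm Finset.card_image_le ?_
    rw [hcard, ← Nat.cast_le (α := ℕ∞), ← h2, ← h3]
    exact h1.trans (M.eRk_le_encard _)
  have hinj : Function.Injective y := by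
    rw [← Finset.card_univ] at h4
    simpa using Finset.card_image_iff.1 h4
  have hy : M.Indep (Set.range y) := by
    rw [Matroid.indep_iff_eRk_eq_encard_of_finite (Set.finite_range y)]
    refine le_antisymm (M.eRk_le_encard _) ?_
    rw [h3, h4, hcard, ← h2]
    exact h1
  exact AlgebraicIndependent.of_subtype_range hinj
    (AlgebraicIndependent.matroid_indep_iff.1 hy)

/-! ### Null sets -/

/-- Fubini and induction: off the zero set of the leading coefficient in the first variable, which
is null, each slice is the finite root set of a nonzero univariate polynomial. -/
theorem volume_zeroSet_fin : ∀ (n : ℕ) (P : MvPolynomial (Fin n) ℂ), P ≠ 0 →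
    volume {x : Fin n → ℂ | eval x P = 0} = 0
  | 0, P, hP => by
    obtain ⟨c, rfl⟩ := C_surjective (Fin 0) P
    have : c ≠ 0 := fun h => hP (by simp [h])
    simp [this]
  | n + 1, P, hP => by
    let e := MeasurableEquiv.piFinSuccAbove (fun _ : Fin (n + 1) => ℂ) 0
    have he : MeasurePreserving e.symm := (volume_preserving_piFinSuccAbove (fun _ => ℂ) 0).symm e
    have hclosed : MeasurableSet {x : Fin (n + 1) → ℂ | eval x P = 0} :=
      (isClosed_eq (MvPolynomial.continuous_eval P) continuous_const).measurableSet
    rw [← he.measure_preimage hclosed.nullMeasurableSet, Measure.volume_eq_prod,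
      ← (Measure.measurePreserving_swap (μ := (volume : Measure (Fin n → ℂ)))
        (ν := (volume : Measure ℂ))).measure_preimage
        (he.measurable hclosed).nullMeasurableSet]
    refine Measure.measure_prod_null_of_ae_null
      (measurable_swap (he.measurable hclosed)) ?_
    have hQ : finSuccEquiv ℂ n P ≠ 0 := by simpa using hP
    have hae := volume_zeroSet_fin n _ (Polynomial.leadingCoeff_ne_zero.2 hQ)
    filter_upwards [measure_eq_zero_iff_ae_notMem.1 hae] with s hs
    have hmap : Polynomial.map (eval s) (finSuccEquiv ℂ n P) ≠ 0 := by
      intro h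
      apply hs
      have := congrArg (fun p => Polynomial.coeff p (finSuccEquiv ℂ n P).natDegree) h
      simpa using this
    refine Set.Finite.measure_zero ?_ _
    refine (Polynomial.finite_setOfPred_isRoot hmap).subset fun z hz => ?_
    have hz' : eval (Fin.cons z s : Fin (n + 1) → ℂ) P = 0 := by
      have : e.symm (z, s) = Fin.cons z s := by
        simp [e, MeasurableEquiv.piFinSuccAbove]
        rfl
      rw [← this]; exact hz
    rw [eval_eq_eval_mv_eval'] at hz'
    exact hz'

theorem volume_zeroSet {ι : Type*} [Fintype ι] (P : MvPolynomial ι ℂ) (hP : P ≠ 0) :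
    volume {x : ι → ℂ | eval x P = 0} = 0 := by
  let e := Fintype.equivFin ι
  have he := volume_measurePreserving_piCongrLeft (fun _ : ι => ℂ) e.symm
  rw [← he.measure_preimage
    (isClosed_eq (MvPolynomial.continuous_eval P) continuous_const).measurableSet.nullMeasurableSet]
  have hr : rename e P ≠ 0 := by
    rw [Ne, map_eq_zero_iff _ (rename_injective _ e.injective)]; exact hP
  convert volume_zeroSet_fin _ (rename e P) hr using 2
  ext x
  simp only [Set.mem_preimage, Set.mem_ofPred_eq, eval_rename]
  have : (MeasurableEquiv.piCongrLeft (fun _ : ι => ℂ) e.symm) x = x ∘ e := by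
    ext i
    obtain ⟨j, rfl⟩ := e.symm.surjective i
    simp [MeasurableEquiv.coe_piCongrLeft]
  rw [this]

/-- There are only countably many rational polynomials, and each nonzero one has a null zero set. -/
theorem volume_not_algebraicIndependent (ι : Type) [Fintype ι] :
    volume {x : ι → ℂ | ¬ AlgebraicIndependent ℚ x} = 0 := by
  have hsub : {x : ι → ℂ | ¬ AlgebraicIndependent ℚ x} ⊆
      ⋃ P : {P : MvPolynomial ι ℚ // P ≠ 0},
        {x | eval x (map (algebraMap ℚ ℂ) P.1) = 0} := by
    intro x hx
    simp only [Set.mem_ofPred_eq, algebraicIndependent_iff, not_forall] at hx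
    obtain ⟨P, h0, hP⟩ := hx
    refine Set.mem_iUnion.2 ⟨⟨P, hP⟩, ?_⟩
    simpa [eval_map, aeval_def] using h0
  have : Countable (MvPolynomial ι ℚ) := by
    have := (MvPolynomial.cardinalMk_le_max (σ := ι) (R := ℚ))
    rw [← Cardinal.mk_le_aleph0_iff]
    simpa using this
  refine measure_mono_null hsub (measure_iUnion_null fun P => volume_zeroSet _ ?_)
  rw [Ne, map_eq_zero_iff _ (map_injective _ (algebraMap ℚ ℂ).injective)]
  exact P.2

/-! ### Poincaré transforms of quadratic fields and their Jacobians at infinity -/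

theorem pderiv_aeval_eq_sum {σ τ : Type*} [Fintype σ] (f : σ → MvPolynomial τ ℂ)
    (q : MvPolynomial σ ℂ) (j : τ) :
    pderiv j (aeval f q) = ∑ i, aeval f (pderiv i q) * pderiv j (f i) := by
  classical
  induction q using MvPolynomial.induction_on with
  | C a => simp [algebraMap_eq]
  | add p q hp hq => simp only [map_add, hp, hq, add_mul, Finset.sum_add_distrib]
  | mul_X p i hp =>
    simp only [map_mul, aeval_X, Derivation.leibniz, hp, pderiv_X, smul_eq_mul, map_add, add_mul,
      Finset.sum_add_distrib, Finset.mul_sum]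
    congr 1
    · simp [Pi.single_apply, apply_ite, ite_mul]
    · exact Finset.sum_congr rfl fun _ _ => by ring

theorem eval_aeval_eq {σ τ : Type*} (f : σ → MvPolynomial τ ℂ) (x : τ → ℂ)
    (q : MvPolynomial σ ℂ) : eval x (aeval f q) = eval (fun i => eval x (f i)) q := by
  induction q using MvPolynomial.induction_on with
  | C a => simp [algebraMap_eq]
  | add p q hp hq => simp only [map_add, hp, hq]
  | mul_X p i hp => simp only [map_mul, hp, aeval_X, eval_X]

theorem eval_aeval_linear {n : ℕ} (S : Matrix (Fin n) (Fin n) ℂ) (x : Fin n → ℂ)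
    (q : MvPolynomial (Fin n) ℂ) :
    eval x (aeval (fun k => ∑ l, C (S k l) * X l) q) = eval (S.mulVec x) q := by
  rw [eval_aeval_eq]
  congr 2
  ext k
  simp [Matrix.mulVec, dotProduct]

theorem eval_vfConj {n : ℕ} (T : Matrix.GeneralLinearGroup (Fin (n + 1)) ℂ)
    (p : Fin (n + 1) → MvPolynomial (Fin (n + 1)) ℂ) (x : Fin (n + 1) → ℂ) (i : Fin (n + 1)) :
    eval x (vfConj T p i) = ∑ j, T.val i j * eval ((T⁻¹).val.mulVec x) (p j) := by
  rw [vfConj, map_sum]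
  refine Finset.sum_congr rfl fun j _ => ?_
  rw [map_mul, eval_C, eval_aeval_linear]

theorem vfJacobian_vfConj {n : ℕ} (T : Matrix.GeneralLinearGroup (Fin (n + 1)) ℂ)
    (p : Fin (n + 1) → MvPolynomial (Fin (n + 1)) ℂ) (x : Fin (n + 1) → ℂ) :
    vfJacobian (vfConj T p) x =
      T.val * vfJacobian p ((T⁻¹).val.mulVec x) * (T⁻¹).val := by
  generalize hS : (T⁻¹).val = S
  ext i j
  have hd : ∀ k, pderiv j (∑ l, C (S k l) * X l : MvPolynomial (Fin (n + 1)) ℂ) =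
      C (S k j) := by
    intro k
    simp [Derivation.leibniz, pderiv_X, Pi.single_apply]
  have hterm : ∀ k, eval x (pderiv j (C (T.val i k) *
      aeval (fun k => ∑ l, C (S k l) * X l) (p k))) =
      ∑ l, T.val i k * eval (S.mulVec x) (pderiv l (p k)) * S l j := by
    intro k
    rw [Derivation.leibniz, pderiv_C, smul_zero, add_zero, smul_eq_mul, map_mul, eval_C,
      pderiv_aeval_eq_sum, map_sum, Finset.mul_sum]
    refine Finset.sum_congr rfl fun l _ => ?_
    rw [map_mul, hd, eval_C, eval_aeval_linear, mul_assoc]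
  simp only [vfJacobian, Matrix.of_apply, vfConj, hS, map_sum, hterm, Matrix.mul_apply,
    Finset.sum_mul]
  exact Finset.sum_comm

theorem isHomogeneous_vfConj {n m : ℕ} (T : Matrix.GeneralLinearGroup (Fin (n + 1)) ℂ)
    {p : Fin (n + 1) → MvPolynomial (Fin (n + 1)) ℂ} (hp : ∀ k, (p k).IsHomogeneous m)
    (k : Fin (n + 1)) : (vfConj T p k).IsHomogeneous m := by
  refine IsHomogeneous.sum _ _ _ fun j _ => ?_
  rw [← zero_add m]
  refine (isHomogeneous_C _ _).mul ?_
  rw [← one_mul m]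
  exact (hp j).aeval _ fun i => IsHomogeneous.sum _ _ _ fun l _ =>
    isHomogeneous_C_mul_X _ _

theorem vfHomogenize_castSucc {n m : ℕ} {h : Fin (n + 1) → MvPolynomial (Fin (n + 1)) ℂ}
    (hh : ∀ k, (h k).IsHomogeneous m) (i : Fin (n + 1)) :
    vfHomogenize m h i.castSucc = rename Fin.castSucc (h i) := by
  rw [vfHomogenize, Fin.snoc_castSucc, Finset.sum_eq_single m]
  · rw [homogeneousComponent_of_mem (hh i)]; simp
  · intro j _ hj
    rw [homogeneousComponent_of_mem (hh i), if_neg hj, map_zero, zero_mul]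
  · simp

/-- The dehomogenization of a polynomial with respect to the first of three variables, the
remaining variables being renamed to the first two of three new ones. -/
noncomputable def dehomog : MvPolynomial (Fin 3) ℂ →ₐ[ℂ] MvPolynomial (Fin 3) ℂ :=
  aeval ![1, X 0, X 1]

theorem eval_dehomog (y : Fin 3 → ℂ) (q : MvPolynomial (Fin 3) ℂ) :
    eval y (dehomog q) = eval ![1, y 0, y 1] q := by
  rw [dehomog, eval_aeval_eq]
  congr 2
  ext k
  fin_cases k <;> simp

theorem pderiv_dehomog (q : MvPolynomial (Fin 3) ℂ) (j : Fin 3) :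
    pderiv j (dehomog q) = ![dehomog (pderiv 1 q), dehomog (pderiv 2 q), 0] j := by
  rw [dehomog, pderiv_aeval_eq_sum, Fin.sum_univ_three]
  fin_cases j <;> simp [pderiv_X]

/-- For a homogeneous field of degree 2 the homogenizing variable enters with exponent 0, so it
survives only in the last component. -/
theorem poincareTransform_eq {h : Fin 3 → MvPolynomial (Fin 3) ℂ}
    (hh : ∀ k, (h k).IsHomogeneous 2) :
    poincareTransform 2 h = ![-dehomog (h 0) * X 0 + dehomog (h 1),
      -dehomog (h 0) * X 1 + dehomog (h 2), -dehomog (h 0) * X 2] := by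
  have key : ∀ q : MvPolynomial (Fin 3) ℂ,
      aeval (Fin.cons (α := fun _ => MvPolynomial (Fin 3) ℂ) 1 X)
        (rename (Fin.castSucc : Fin 3 → Fin 4) q) = dehomog q := by
    intro q
    rw [aeval_rename, dehomog]
    congr 2
    ext k : 1
    fin_cases k <;> rfl
  have h0 : vfHomogenize 2 h 0 = rename Fin.castSucc (h 0) := vfHomogenize_castSucc hh 0
  have h1 : vfHomogenize 2 h 1 = rename Fin.castSucc (h 1) := vfHomogenize_castSucc hh 1
  have h2 : vfHomogenize 2 h 2 = rename Fin.castSucc (h 2) := vfHomogenize_castSucc hh 2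
  have h3 : vfHomogenize 2 h 3 = 0 := Fin.snoc_last (α := fun _ => MvPolynomial (Fin 4) ℂ) _ _
  have hX0 : (Fin.cons (α := fun _ => MvPolynomial (Fin 3) ℂ) 1 X : Fin 4 → _) 0 = 1 := rfl
  have hX : ∀ k : Fin 3,
      (Fin.cons (α := fun _ => MvPolynomial (Fin 3) ℂ) 1 X : Fin 4 → _) k.succ = X k :=
    fun _ => rfl
  have hk : ∀ k : Fin 3, poincareTransform 2 h k = -dehomog (h 0) * X k +
      aeval (Fin.cons (α := fun _ => MvPolynomial (Fin 3) ℂ) 1 X) (vfHomogenize 2 h k.succ) := by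
    intro k
    rw [poincareTransform, vfProject, map_add, map_mul, map_mul, map_neg, aeval_X, aeval_X, hX0,
      hX, h0, key, one_mul]
  ext1 k
  rw [hk]
  fin_cases k
  · exact congrArg (_ + ·) ((congrArg _ h1).trans (key _))
  · exact congrArg (_ + ·) ((congrArg _ h2).trans (key _))
  · exact (congrArg (_ + ·) ((congrArg _ h3).trans (map_zero _))).trans (add_zero _)

/-- For a Jacobian `D` with the eigenvalue `2 * μ`: its other eigenvalues are `a`, `c` (expressed by
traces), and the resulting eigenvalues at infinity are linearly independent over `ℚ`. -/
def GoodAt (D : Matrix (Fin 3) (Fin 3) ℂ) (μ : ℂ) : Prop :=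
  ∃ a c : ℂ, D.trace = 2 * μ + a + c ∧ (D * D).trace = 4 * μ ^ 2 + a ^ 2 + c ^ 2 ∧
    LinearIndependent ℚ ![-μ, a - μ, c - μ]

theorem vfJacobian_mulVec {n m : ℕ} {h : Fin (n + 1) → MvPolynomial (Fin (n + 1)) ℂ}
    (hh : ∀ k, (h k).IsHomogeneous m) (x : Fin (n + 1) → ℂ) (k : Fin (n + 1)) :
    ∑ j, vfJacobian h x k j * x j = m * eval x (h k) := by
  have := congrArg (eval x) (hh k).sum_X_mul_pderiv
  simp only [map_sum, map_mul, eval_X, nsmul_eq_mul, map_natCast] at this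
  rw [← this]
  exact Finset.sum_congr rfl fun _ _ => mul_comm _ _

theorem vfJacobian_poincareTransform {h : Fin 3 → MvPolynomial (Fin 3) ℂ}
    (hh : ∀ k, (h k).IsHomogeneous 2) (y : Fin 3 → ℂ) (hy : y 2 = 0) (μ : ℂ)
    (hμ : eval ![1, y 0, y 1] (h 0) = μ) (D : Matrix (Fin 3) (Fin 3) ℂ)
    (hD : D = vfJacobian h ![1, y 0, y 1]) :
    vfJacobian (poincareTransform 2 h) y =
      !![D 1 1 - y 0 * D 0 1 - μ, D 1 2 - y 0 * D 0 2, 0;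
         D 2 1 - y 1 * D 0 1, D 2 2 - y 1 * D 0 2 - μ, 0;
         0, 0, -μ] := by
  subst hμ hD
  rw [poincareTransform_eq hh]
  ext i j
  fin_cases i <;> fin_cases j <;>
    simp [vfJacobian, Derivation.leibniz, pderiv_dehomog, pderiv_X, eval_dehomog, hy] <;> ring

/-- The vector (1, s, t) is an eigenvector of `D` for 2μ, and the matrix `N` is the map induced by
`D` on the quotient by it. The two trace identities determine the trace a + c and the determinant a
c of `N`; they are used instead of eigenvalues of `D` because traces are visibly invariant under
conjugation. -/
theorem roots_charpoly_of_block {D : Matrix (Fin 3) (Fin 3) ℂ} {s t μ a c : ℂ}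
    (hD : ∀ i, D i 0 + D i 1 * s + D i 2 * t = 2 * (μ * ![1, s, t] i))
    (ht : D.trace = 2 * μ + a + c) (ht2 : (D * D).trace = 4 * μ ^ 2 + a ^ 2 + c ^ 2) :
    (!![D 1 1 - s * D 0 1 - μ, D 1 2 - s * D 0 2, 0;
        D 2 1 - t * D 0 1, D 2 2 - t * D 0 2 - μ, 0;
        0, 0, -μ] : Matrix (Fin 3) (Fin 3) ℂ).charpoly.roots =
      Multiset.map ![-μ, a - μ, c - μ] Finset.univ.val := by
  have h0 : D 0 0 = 2 * μ - D 0 1 * s - D 0 2 * t := by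
    have := hD 0; simp at this; linear_combination this
  have h1 : D 1 0 = 2 * (μ * s) - D 1 1 * s - D 1 2 * t := by
    have := hD 1; simp at this; linear_combination this
  have h2 : D 2 0 = 2 * (μ * t) - D 2 1 * s - D 2 2 * t := by
    have := hD 2; simp at this; linear_combination this
  rw [Matrix.trace_fin_three] at ht ht2
  simp only [Matrix.mul_apply, Fin.sum_univ_three, h0, h1, h2] at ht ht2
  set N00 := D 1 1 - s * D 0 1 with hN00
  set N01 := D 1 2 - s * D 0 2 with hN01
  set N10 := D 2 1 - t * D 0 1 with hN10
  set N11 := D 2 2 - t * D 0 2 with hN11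
  have htr : N00 + N11 = a + c := by linear_combination ht
  have htr2 : N00 ^ 2 + 2 * N01 * N10 + N11 ^ 2 = a ^ 2 + c ^ 2 := by
    simp only [hN00, hN01, hN10, hN11]; linear_combination ht2
  have hdet : N00 * N11 - N01 * N10 = a * c := by
    linear_combination (N00 + N11 + a + c) / 2 * htr - htr2 / 2
  have hchar : (!![N00 - μ, N01, 0; N10, N11 - μ, 0; 0, 0, -μ] :
      Matrix (Fin 3) (Fin 3) ℂ).charpoly =
      (Multiset.map (fun r => Polynomial.X - Polynomial.C r)
        (Multiset.map ![-μ, a - μ, c - μ] Finset.univ.val)).prod := by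
    refine Polynomial.funext fun z => ?_
    rw [Matrix.eval_charpoly, Matrix.det_fin_three]
    have huniv : (Finset.univ : Finset (Fin 3)).val = {0, 1, 2} := rfl
    simp [huniv]
    linear_combination (z + μ) * (-(z + μ) * htr + hdet)
  rw [hchar, Polynomial.roots_multiset_prod_X_sub_C]

theorem propertyE_of_goodAt {p : Fin 3 → MvPolynomial (Fin 3) ℂ}
    (hp : ∀ k, (p k).IsHomogeneous 2) (hdeg : vfDegree p = 2)
    (H : ∀ w : Fin 3 → ℂ, w ≠ 0 → ∀ μ : ℂ, (∀ k, eval w (p k) = μ * w k) →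
      GoodAt (vfJacobian p w) μ) : PropertyE p := by
  intro v _ T _ y hy hstat
  rw [hdeg] at hstat ⊢
  have hh := isHomogeneous_vfConj T hp
  set h := vfConj T p with hdef
  set x : Fin 3 → ℂ := ![1, y 0, y 1] with hx
  set μ := eval x (h 0) with hμ
  have hy2 : y 2 = 0 := hy
  have hT : T.val * (T⁻¹).val = 1 := by
    rw [← Units.val_mul, mul_inv_cancel]; rfl
  have hT' : (T⁻¹).val * T.val = 1 := by
    rw [← Units.val_mul, inv_mul_cancel]; rfl
  have hst : ∀ k, eval x (h k) = μ * x k := by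
    have h0 := hstat 0
    have h1 := hstat 1
    rw [poincareTransform_eq hh] at h0 h1
    simp only [Matrix.cons_val_zero, Matrix.cons_val_one, map_add, map_mul, map_neg, eval_X]
      at h0 h1
    have e : ∀ q, eval (σ := Fin (2 + 1)) y (dehomog q) = eval x q := eval_dehomog y
    rw [e, e] at h0 h1
    intro k
    fin_cases k
    · simp [hx, hμ]
    · change eval x (h 1) = μ * y 0
      linear_combination h0
    · change eval x (h 2) = μ * y 1
      linear_combination h1
  -- Pulling the stationary point back by `T` gives an invariant line of `p`, so the choice of `v`
  -- and `T` no longer matters.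
  set w := (T⁻¹).val.mulVec x with hw
  have hxw : T.val.mulVec w = x := by rw [hw, Matrix.mulVec_mulVec, hT, Matrix.one_mulVec]
  have hw0 : w ≠ 0 := by
    intro h0
    have := congrFun hxw 0
    rw [h0, Matrix.mulVec_zero] at this
    simp [hx] at this
  have hpw : ∀ k, eval w (p k) = μ * w k := by
    have h1 : T.val.mulVec (fun j => eval w (p j)) = μ • x := by
      ext i
      rw [Pi.smul_apply, smul_eq_mul, ← hst i, hdef, eval_vfConj]
      rfl
    have h2 := congrArg (T⁻¹).val.mulVec h1
    rw [Matrix.mulVec_mulVec, hT', Matrix.one_mulVec, Matrix.mulVec_smul] at h2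
    exact fun k => congrFun h2 k
  obtain ⟨a, c, ht, ht2, hli⟩ := H w hw0 μ hpw
  have hJ : vfJacobian h x = T.val * vfJacobian p w * (T⁻¹).val := vfJacobian_vfConj T p x
  refine ⟨![-μ, a - μ, c - μ], ?_, Or.inl hli⟩
  rw [vfJacobian_poincareTransform hh y hy2 μ rfl _ rfl]
  refine roots_charpoly_of_block (fun i => ?_) ?_ ?_
  · have := vfJacobian_mulVec hh x i
    rw [Fin.sum_univ_three, hst] at this
    simpa [hx] using this
  · rw [← hx, hJ, Matrix.trace_mul_comm, ← mul_assoc, hT', one_mul, ht]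
  · rw [← hx, hJ, ← ht2]
    have : T.val * vfJacobian p w * (T⁻¹).val * (T.val * vfJacobian p w * (T⁻¹).val) =
        T.val * (vfJacobian p w * vfJacobian p w * (T⁻¹).val) := by
      simp only [mul_assoc]
      rw [← mul_assoc (T⁻¹).val, hT', one_mul]
    rw [this, Matrix.trace_mul_comm, mul_assoc, hT', mul_one]

/-- This and `GoodAt.of_submatrix` allow w to be rescaled and its coordinates permuted so that it
becomes (1, s, t). -/
theorem GoodAt.of_smul {D : Matrix (Fin 3) (Fin 3) ℂ} {μ r : ℂ} (hr : r ≠ 0)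
    (h : GoodAt (r • D) (r * μ)) : GoodAt D μ := by
  obtain ⟨a, c, ht, ht2, hli⟩ := h
  refine ⟨r⁻¹ * a, r⁻¹ * c, ?_, ?_, ?_⟩
  · rw [Matrix.trace_smul, smul_eq_mul] at ht
    field_simp
    linear_combination ht
  · rw [Matrix.smul_mul, Matrix.mul_smul, Matrix.trace_smul, Matrix.trace_smul, smul_eq_mul,
      smul_eq_mul] at ht2
    field_simp
    linear_combination ht2
  · refine LinearIndependent.of_comp (LinearMap.mulLeft ℚ r) ?_
    have : (LinearMap.mulLeft ℚ r ∘ ![-μ, r⁻¹ * a - μ, r⁻¹ * c - μ] : Fin 3 → ℂ) =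
        ![-(r * μ), a - r * μ, c - r * μ] := by
      ext i
      fin_cases i <;> simp [mul_sub, hr]
    rw [this]
    exact hli

theorem GoodAt.of_submatrix {D : Matrix (Fin 3) (Fin 3) ℂ} {μ : ℂ} (σ : Equiv.Perm (Fin 3))
    (h : GoodAt (D.submatrix σ σ) μ) : GoodAt D μ := by
  have htr : ∀ M : Matrix (Fin 3) (Fin 3) ℂ, (M.submatrix σ σ).trace = M.trace := fun M =>
    Equiv.sum_comp σ fun i => M i i
  rw [GoodAt, Matrix.submatrix_mul_equiv, htr, htr] at h
  exact h

/-! ### From algebraic to linear independence -/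

theorem linearIndependent_of_forall_rat {μ a c : ℂ}
    (h : ∀ q r s : ℚ, (q : ℂ) * μ + r * a + s * c = 0 → r = 0 ∧ s = 0 ∧ q = 0) :
    LinearIndependent ℚ ![-μ, a - μ, c - μ] := by
  rw [Fintype.linearIndependent_iff]
  intro g hg
  simp [Fin.sum_univ_three, Rat.smul_def] at hg
  obtain ⟨h1, h2, h0⟩ := h (-g 0 - g 1 - g 2) (g 1) (g 2) (by
    push_cast; linear_combination hg)
  intro i
  fin_cases i
  · simp; linarith
  · exact h1
  · exact h2

theorem linearIndependent_of_algebraicIndependent_three {μ a c : ℂ}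
    (h : AlgebraicIndependent ℚ ![μ, a, c]) : LinearIndependent ℚ ![-μ, a - μ, c - μ] := by
  refine linearIndependent_of_forall_rat fun q r s hq => ?_
  have hP := (algebraicIndependent_iff.1 h)
    (C q * X 0 + C r * X 1 + C s * X 2) (by simpa [aeval_def] using hq)
  have e := fun v => congrArg (eval (v : Fin 3 → ℚ)) hP
  refine ⟨?_, ?_, ?_⟩
  · simpa using e ![0, 1, 0]
  · simpa using e ![0, 0, 1]
  · simpa using e ![1, 0, 0]

theorem linearIndependent_of_algebraicIndependent_two {a c : ℂ}
    (h : AlgebraicIndependent ℚ ![a, c]) : LinearIndependent ℚ ![-1, a - 1, c - 1] := by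
  refine linearIndependent_of_forall_rat fun q r s hq => ?_
  have hP := (algebraicIndependent_iff.1 h)
    (C q + C r * X 0 + C s * X 1) (by simpa [aeval_def] using hq)
  have e := fun v => congrArg (eval (v : Fin 2 → ℚ)) hP
  have h0 : q = 0 := by simpa using e ![0, 0]
  refine ⟨?_, ?_, h0⟩
  · simpa [h0] using e ![1, 0]
  · simpa [h0] using e ![0, 1]

theorem exists_add_eq_and_mul_eq (u v : ℂ) : ∃ a c : ℂ, a + c = u ∧ a * c = v := by
  obtain ⟨d, hd⟩ := IsAlgClosed.exists_pow_nat_eq (u ^ 2 - 4 * v) two_pos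
  exact ⟨(u + d) / 2, (u - d) / 2, by ring, by linear_combination -hd / 4⟩

/-! ### The parameter count at an invariant line -/

/-- The numbers a, c are the eigenvalues of the quotient map `N` on ℂ³ / ⟨(1, s, t)⟩. Conversely, a,
c and the off-diagonal entries of `N` determine its diagonal up to a quadratic equation; then the
first row of `D` yields its last two columns. -/
theorem exists_eigenvalues {D : Matrix (Fin 3) (Fin 3) ℂ} {s t μ : ℂ}
    (hD : ∀ i, D i 0 + D i 1 * s + D i 2 * t = 2 * (μ * ![1, s, t] i)) :
    ∃ a c : ℂ, D.trace = 2 * μ + a + c ∧ (D * D).trace = 4 * μ ^ 2 + a ^ 2 + c ^ 2 ∧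
      ∀ F : Subfield ℂ, QuadClosed F → s ∈ F → t ∈ F → a ∈ F → c ∈ F →
        D 1 2 - s * D 0 2 ∈ F → D 2 1 - t * D 0 1 ∈ F → D 0 1 ∈ F → D 0 2 ∈ F →
        ∀ k, D k 1 ∈ F ∧ D k 2 ∈ F := by
  have h0 : D 0 0 = 2 * μ - D 0 1 * s - D 0 2 * t := by
    have := hD 0; simp at this; linear_combination this
  have h1 : D 1 0 = 2 * (μ * s) - D 1 1 * s - D 1 2 * t := by
    have := hD 1; simp at this; linear_combination this
  have h2 : D 2 0 = 2 * (μ * t) - D 2 1 * s - D 2 2 * t := by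
    have := hD 2; simp at this; linear_combination this
  obtain ⟨a, c, hac, hac2⟩ := exists_add_eq_and_mul_eq
    (D 1 1 - s * D 0 1 + (D 2 2 - t * D 0 2))
    ((D 1 1 - s * D 0 1) * (D 2 2 - t * D 0 2) - (D 1 2 - s * D 0 2) * (D 2 1 - t * D 0 1))
  refine ⟨a, c, ?_, ?_, ?_⟩
  · rw [Matrix.trace_fin_three, h0]; linear_combination -hac
  · rw [Matrix.trace_fin_three]
    simp only [Matrix.mul_apply, Fin.sum_univ_three, h0, h1, h2]
    linear_combination
      -(a + c + (D 1 1 - s * D 0 1 + (D 2 2 - t * D 0 2))) * hac + 2 * hac2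
  · intro F hF hs ht ha hc h12 h21 h01 h02
    have hN : D 1 1 - s * D 0 1 ∈ F := by
      -- The entry N₀₀ is a root of z² - (a + c) z + a c + N₀₁ N₁₀. This is the only use of
      -- `QuadClosed`.
      refine hF (-(a + c)) (neg_mem (add_mem ha hc))
        (a * c + (D 1 2 - s * D 0 2) * (D 2 1 - t * D 0 1))
        (add_mem (mul_mem ha hc) (mul_mem h12 h21)) _ ?_
      rw [hac, hac2]; ring
    have hN' : D 2 2 - t * D 0 2 ∈ F := by
      have : D 2 2 - t * D 0 2 = a + c - (D 1 1 - s * D 0 1) := by rw [hac]; ring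
      rw [this]
      exact sub_mem (add_mem ha hc) hN
    have back : ∀ {u v w : ℂ}, u - v * w ∈ F → v ∈ F → w ∈ F → u ∈ F := fun h hv hw => by
      have := add_mem h (mul_mem hv hw)
      rwa [sub_add_cancel] at this
    intro k
    fin_cases k
    · exact ⟨h01, h02⟩
    · exact ⟨back hN hs h01, back h12 hs h02⟩
    · exact ⟨back h21 ht h01, back hN' ht h02⟩

/-- The Jacobian at `w` of the quadratic map with symmetric coefficients `b`. -/
def quadJacobian (b : Fin 3 → Fin 3 → Fin 3 → ℂ) (w : Fin 3 → ℂ) : Matrix (Fin 3) (Fin 3) ℂ :=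
  Matrix.of fun k l => 2 * ∑ i, b i l k * w i

/-- The quadratic map with coefficients `b`. -/
def quadMap (b : Fin 3 → Fin 3 → Fin 3 → ℂ) (w : Fin 3 → ℂ) : Fin 3 → ℂ :=
  fun k => ∑ i, ∑ j, b i j k * (w i * w j)

theorem quadJacobian_mulVec {b : Fin 3 → Fin 3 → Fin 3 → ℂ} {s t μ : ℂ}
    (hstat : quadMap b ![1, s, t] = μ • ![1, s, t]) (i : Fin 3) :
    quadJacobian b ![1, s, t] i 0 + quadJacobian b ![1, s, t] i 1 * s +
      quadJacobian b ![1, s, t] i 2 * t = 2 * (μ * ![1, s, t] i) := by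
  have := congrFun hstat i
  rw [Pi.smul_apply, smul_eq_mul] at this
  rw [← this]
  simp [quadMap, quadJacobian, Fin.sum_univ_three]
  ring

theorem forall_mem_of_symm {b : Fin 3 → Fin 3 → Fin 3 → ℂ} (hb : ∀ i j k, b i j k = b j i k)
    {F : Subfield ℂ} (h00 : ∀ k, b 0 0 k ∈ F) (h01 : ∀ k, b 0 1 k ∈ F) (h02 : ∀ k, b 0 2 k ∈ F)
    (h11 : ∀ k, b 1 1 k ∈ F) (h12 : ∀ k, b 1 2 k ∈ F) (h22 : ∀ k, b 2 2 k ∈ F) :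
    ∀ i j k, b i j k ∈ F := by
  intro i j k
  fin_cases i <;> fin_cases j
  · exact h00 k
  · exact h01 k
  · exact h02 k
  · exact hb 0 1 k ▸ h01 k
  · exact h11 k
  · exact h12 k
  · exact hb 0 2 k ▸ h02 k
  · exact hb 1 2 k ▸ h12 k
  · exact h22 k

theorem forall_fin_three_mem {f : Fin 3 → ℂ} {F : Subfield ℂ} (h0 : f 0 ∈ F) (h1 : f 1 ∈ F)
    (h2 : f 2 ∈ F) : ∀ k, f k ∈ F := fun k => by fin_cases k <;> assumption

theorem two_mem (F : Subfield ℂ) : (2 : ℂ) ∈ F := ofNat_mem F 2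

theorem algebraicIndependent_initial {m n : ℕ} {x : Fin n → ℂ} (hx : AlgebraicIndependent ℚ x)
    (h : m ≤ n) {z : Fin m → ℂ} (hz : ∀ i, z i = x (Fin.castLE h i)) :
    AlgebraicIndependent ℚ z := by
  rw [show z = x ∘ Fin.castLE h from funext hz]
  exact hx.comp _ (Fin.castLE_injective h)

theorem goodAt_of_generic {ι : Type*} [Fintype ι] (hcard : Fintype.card ι = 18) {x : ι → ℂ}
    (hx : AlgebraicIndependent ℚ x) {b : Fin 3 → Fin 3 → Fin 3 → ℂ}
    (hb : ∀ i j k, b i j k = b j i k)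
    (hgen : ∀ F : Subfield ℂ, (∀ i j k, b i j k ∈ F) → ∀ i, x i ∈ F) {s t μ : ℂ}
    (hstat : quadMap b ![1, s, t] = μ • ![1, s, t]) :
    GoodAt (quadJacobian b ![1, s, t]) μ := by
  have hDw := quadJacobian_mulVec hstat
  have hD1 : ∀ k, quadJacobian b ![1, s, t] k 1 = 2 * (b 0 1 k + b 1 1 k * s + b 1 2 k * t) := by
    intro k; simp [quadJacobian, Fin.sum_univ_three, hb 2 1]
  have hD2 : ∀ k, quadJacobian b ![1, s, t] k 2 = 2 * (b 0 2 k + b 1 2 k * s + b 2 2 k * t) := by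
    intro k; simp [quadJacobian, Fin.sum_univ_three]
  have hst : ∀ k, b 0 0 k = μ * ![1, s, t] k - (2 * b 0 1 k * s + 2 * b 0 2 k * t
      + b 1 1 k * s * s + 2 * b 1 2 k * s * t + b 2 2 k * t * t) := by
    intro k
    have := congrFun hstat k
    rw [Pi.smul_apply, smul_eq_mul] at this
    rw [← this]
    simp [quadMap, Fin.sum_univ_three, hb 1 0, hb 2 0, hb 2 1]
    ring
  generalize quadJacobian b ![1, s, t] = D at *
  obtain ⟨a, c, ht, ht2, hF⟩ := exists_eigenvalues hDw
  refine ⟨a, c, ht, ht2, linearIndependent_of_algebraicIndependent_three ?_⟩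
  -- Eighteen numbers: `b 0 1` and `b 0 2` are recovered from the columns of `D`, and then `b 0 0`
  -- from the equation p(w) = μ w.
  have hy : AlgebraicIndependent ℚ ![μ, a, c, s, t, D 1 2 - s * D 0 2, D 2 1 - t * D 0 1, D 0 1,
      D 0 2, b 1 1 0, b 1 1 1, b 1 1 2, b 1 2 0, b 1 2 1, b 1 2 2, b 2 2 0, b 2 2 1, b 2 2 2] := by
    refine algebraicIndependent_of_generate hx (by rw [hcard]; rfl) fun F hFq hF' => hgen F ?_
    simp only [Fin.forall_fin_succ, Matrix.cons_val_zero, Matrix.cons_val_succ] at hF'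
    obtain ⟨hμ, ha, hc, hs, ht, hN, hN', h01, h02, h110, h111, h112, h120, h121, h122, h220, h221,
      h222, -⟩ := hF'
    have h11 : ∀ k, b 1 1 k ∈ F := forall_fin_three_mem h110 h111 h112
    have h12 : ∀ k, b 1 2 k ∈ F := forall_fin_three_mem h120 h121 h122
    have h22 : ∀ k, b 2 2 k ∈ F := forall_fin_three_mem h220 h221 h222
    have hDF := hF F hFq hs ht ha hc hN hN' h01 h02
    have two := two_mem F
    have h01' : ∀ k, b 0 1 k ∈ F := fun k => by
      have : b 0 1 k = D k 1 / 2 - b 1 1 k * s - b 1 2 k * t := by rw [hD1]; ring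
      rw [this]
      exact sub_mem (sub_mem (div_mem (hDF k).1 two) (mul_mem (h11 k) hs)) (mul_mem (h12 k) ht)
    have h02' : ∀ k, b 0 2 k ∈ F := fun k => by
      have : b 0 2 k = D k 2 / 2 - b 1 2 k * s - b 2 2 k * t := by rw [hD2]; ring
      rw [this]
      exact sub_mem (sub_mem (div_mem (hDF k).2 two) (mul_mem (h12 k) hs)) (mul_mem (h22 k) ht)
    have hw : ∀ k, (![1, s, t] : Fin 3 → ℂ) k ∈ F := forall_fin_three_mem (one_mem F) hs ht
    refine forall_mem_of_symm hb (fun k => ?_) h01' h02' h11 h12 h22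
    rw [hst]
    refine sub_mem (mul_mem hμ (hw k)) (add_mem (add_mem (add_mem (add_mem ?_ ?_) ?_) ?_) ?_)
    · exact mul_mem (mul_mem two (h01' k)) hs
    · exact mul_mem (mul_mem two (h02' k)) ht
    · exact mul_mem (mul_mem (h11 k) hs) hs
    · exact mul_mem (mul_mem (mul_mem two (h12 k)) hs) ht
    · exact mul_mem (mul_mem (h22 k) ht) ht
  have h3 : 3 ≤ 18 := by decide
  exact algebraicIndependent_initial hy h3 fun i => by fin_cases i <;> rfl

theorem goodAt_of_generic_of_basis_idempotent {ι : Type*} [Fintype ι]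
    (hcard : Fintype.card ι = 9) {x : ι → ℂ}
    (hx : AlgebraicIndependent ℚ x) {b : Fin 3 → Fin 3 → Fin 3 → ℂ}
    (hb : ∀ i j k, b i j k = b j i k) (hdiag : ∀ i k, b i i k = (1 : Matrix (Fin 3) (Fin 3) ℂ) i k)
    (hgen : ∀ F : Subfield ℂ, (∀ i j k, b i j k ∈ F) → ∀ i, x i ∈ F) {s t μ : ℂ}
    (hstat : quadMap b ![1, s, t] = μ • ![1, s, t]) :
    GoodAt (quadJacobian b ![1, s, t]) μ := by
  have hDw := quadJacobian_mulVec hstat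
  have hD1 : ∀ k, quadJacobian b ![1, s, t] k 1 = 2 * (b 0 1 k + b 1 1 k * s + b 1 2 k * t) := by
    intro k; simp [quadJacobian, Fin.sum_univ_three, hb 2 1]
  have hD2 : ∀ k, quadJacobian b ![1, s, t] k 2 = 2 * (b 0 2 k + b 1 2 k * s + b 2 2 k * t) := by
    intro k; simp [quadJacobian, Fin.sum_univ_three]
  have hst : ∀ k, b 0 0 k + 2 * b 0 1 k * s + 2 * b 0 2 k * t
      + b 1 1 k * s * s + 2 * b 1 2 k * s * t + b 2 2 k * t * t = μ * ![1, s, t] k := by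
    intro k
    have := congrFun hstat k
    rw [Pi.smul_apply, smul_eq_mul] at this
    rw [← this]
    simp [quadMap, Fin.sum_univ_three, hb 1 0, hb 2 0, hb 2 1]
    ring
  have hdiagF : ∀ (F : Subfield ℂ) i k, b i i k ∈ F := fun F i k => by
    rw [hdiag, Matrix.one_apply]
    split_ifs
    exacts [one_mem F, zero_mem F]
  have hbAI : AlgebraicIndependent ℚ ![b 0 1 0, b 0 1 1, b 0 1 2, b 0 2 0, b 0 2 1, b 0 2 2,
      b 1 2 0, b 1 2 1, b 1 2 2] := by
    refine algebraicIndependent_of_generate hx (by rw [hcard]; rfl) fun F hFq hF' => hgen F ?_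
    simp only [Fin.forall_fin_succ, Matrix.cons_val_zero, Matrix.cons_val_succ] at hF'
    obtain ⟨h010, h011, h012, h020, h021, h022, h120, h121, h122, -⟩ := hF'
    exact forall_mem_of_symm hb (hdiagF F 0) (forall_fin_three_mem h010 h011 h012)
      (forall_fin_three_mem h020 h021 h022) (hdiagF F 1) (forall_fin_three_mem h120 h121 h122)
      (hdiagF F 2)
  generalize quadJacobian b ![1, s, t] = D at *
  obtain ⟨a, c, htr, htr2, hF⟩ := exists_eigenvalues hDw
  refine ⟨a, c, htr, htr2, ?_⟩
  by_cases hs : s = 0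
  · by_cases ht : t = 0
    · subst hs ht
      have hμ : μ = 1 := by simpa [hdiag] using (hst 0).symm
      subst hμ
      refine linearIndependent_of_algebraicIndependent_two ?_
      -- On the line of a basis idempotent, s, t and μ are constants, so the three coefficients `b 1
      -- 2` take their place in the count.
      have hy : AlgebraicIndependent ℚ ![a, c, D 1 2 - 0 * D 0 2, D 2 1 - 0 * D 0 1, D 0 1,
          D 0 2, b 1 2 0, b 1 2 1, b 1 2 2] := by
        refine algebraicIndependent_of_generate hx (by rw [hcard]; rfl) fun F hFq hF' => hgen F ?_
        simp only [Fin.forall_fin_succ, Matrix.cons_val_zero, Matrix.cons_val_succ] at hF'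
        obtain ⟨ha, hc, hN, hN', h01, h02, h120, h121, h122, -⟩ := hF'
        have hDF := hF F hFq (zero_mem F) (zero_mem F) ha hc hN hN' h01 h02
        have two := two_mem F
        refine forall_mem_of_symm hb (hdiagF F 0) (fun k => ?_) (fun k => ?_) (hdiagF F 1)
          (forall_fin_three_mem h120 h121 h122) (hdiagF F 2)
        · have : b 0 1 k = D k 1 / 2 := by rw [hD1]; ring
          exact this ▸ div_mem (hDF k).1 two
        · have : b 0 2 k = D k 2 / 2 := by rw [hD2]; ring
          exact this ▸ div_mem (hDF k).2 two
      have h3 : 2 ≤ 9 := by decide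
      exact algebraicIndependent_initial hy h3 fun i => by fin_cases i <;> rfl
    -- On a coordinate plane off the axes, the vanishing coordinate of p(w) = μ w forces a mixed
    -- coefficient to be 0, against independence.
    · have h1 := hst 1
      simp [hs, hdiag, ht] at h1
      exact absurd h1 (hbAI.ne_zero 4)
  · by_cases ht : t = 0
    · have h1 := hst 2
      simp [hs, hdiag, ht] at h1
      exact absurd h1 (hbAI.ne_zero 2)
    · refine linearIndependent_of_algebraicIndependent_three ?_
      have hy : AlgebraicIndependent ℚ ![μ, a, c, s, t, D 1 2 - s * D 0 2, D 2 1 - t * D 0 1,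
          D 0 1, D 0 2] := by
        refine algebraicIndependent_of_generate hx (by rw [hcard]; rfl) fun F hFq hF' => hgen F ?_
        simp only [Fin.forall_fin_succ, Matrix.cons_val_zero, Matrix.cons_val_succ] at hF'
        obtain ⟨hμF, ha, hc, hsF, htF, hN, hN', h01, h02, -⟩ := hF'
        have hDF := hF F hFq hsF htF ha hc hN hN' h01 h02
        have two := two_mem F
        have hw : ∀ k, (![1, s, t] : Fin 3 → ℂ) k ∈ F :=
          forall_fin_three_mem (one_mem F) hsF htF
        -- Subtracting p(w) = μ w from s times column 1 plus t times column 2 of `D` cancels `b 0 1`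
        -- and `b 0 2`, leaving 2 s t times `b 1 2` and known terms.
        have h12 : ∀ k, b 1 2 k ∈ F := fun k => by
          have : b 1 2 k = (s * D k 1 + t * D k 2 - μ * ![1, s, t] k + b 0 0 k
              - s * s * b 1 1 k - t * t * b 2 2 k) / (2 * s * t) := by
            rw [eq_div_iff (by simp [hs, ht]), ← hst, hD1, hD2]; ring
          rw [this]
          refine div_mem (sub_mem (sub_mem (add_mem (sub_mem (add_mem ?_ ?_) ?_) ?_) ?_) ?_)
            (mul_mem (mul_mem two hsF) htF)
          · exact mul_mem hsF (hDF k).1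
          · exact mul_mem htF (hDF k).2
          · exact mul_mem hμF (hw k)
          · exact hdiagF F 0 k
          · exact mul_mem (mul_mem hsF hsF) (hdiagF F 1 k)
          · exact mul_mem (mul_mem htF htF) (hdiagF F 2 k)
        refine forall_mem_of_symm hb (hdiagF F 0) (fun k => ?_) (fun k => ?_) (hdiagF F 1)
          h12 (hdiagF F 2)
        · have : b 0 1 k = D k 1 / 2 - b 1 1 k * s - b 1 2 k * t := by rw [hD1]; ring
          rw [this]
          exact sub_mem (sub_mem (div_mem (hDF k).1 two) (mul_mem (hdiagF F 1 k) hsF))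
            (mul_mem (h12 k) htF)
        · have : b 0 2 k = D k 2 / 2 - b 1 2 k * s - b 2 2 k * t := by rw [hD2]; ring
          rw [this]
          exact sub_mem (sub_mem (div_mem (hDF k).2 two) (mul_mem (h12 k) hsF))
            (mul_mem (hdiagF F 2 k) htF)
      have h3 : 3 ≤ 9 := by decide
      exact algebraicIndependent_initial hy h3 fun i => by fin_cases i <;> rfl

/-! ### Property E in terms of symmetric coefficients -/

/-- The homogeneous quadratic vector field with coefficients `b`. -/
noncomputable def symField (b : Fin 3 → Fin 3 → Fin 3 → ℂ) : Fin 3 → MvPolynomial (Fin 3) ℂ :=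
  fun k => ∑ i, ∑ j, C (b i j k) * (X i * X j)

theorem isHomogeneous_symField (b : Fin 3 → Fin 3 → Fin 3 → ℂ) (k : Fin 3) :
    (symField b k).IsHomogeneous 2 :=
  IsHomogeneous.sum _ _ _ fun _ _ => IsHomogeneous.sum _ _ _ fun _ _ =>
    ((isHomogeneous_X _ _).mul (isHomogeneous_X _ _)).C_mul _

theorem eval_symField (b : Fin 3 → Fin 3 → Fin 3 → ℂ) (w : Fin 3 → ℂ) (k : Fin 3) :
    eval w (symField b k) = quadMap b w k := by
  simp [symField, quadMap]

theorem vfJacobian_symField {b : Fin 3 → Fin 3 → Fin 3 → ℂ} (hb : ∀ i j k, b i j k = b j i k)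
    (w : Fin 3 → ℂ) : vfJacobian (symField b) w = quadJacobian b w := by
  ext k l
  simp only [vfJacobian, Matrix.of_apply, symField, map_sum, quadJacobian, Derivation.leibniz,
    pderiv_C, pderiv_X, smul_eq_mul, map_mul, map_add, eval_C, eval_X]
  fin_cases l <;> simp [Fin.sum_univ_three, hb 1 0, hb 2 0, hb 2 1] <;> ring

theorem vfDegree_eq_two {p : Fin 3 → MvPolynomial (Fin 3) ℂ} (hp : ∀ k, (p k).IsHomogeneous 2)
    (hne : ∃ k, p k ≠ 0) : vfDegree p = 2 := by
  obtain ⟨k, hk⟩ := hne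
  refine le_antisymm (Finset.sup_le fun i _ => (hp i).totalDegree_le) ?_
  exact ((hp k).totalDegree hk).symm.le.trans <|
    Finset.le_sup (f := fun i => (p i).totalDegree) (Finset.mem_univ k)

/-- Simultaneous permutation of variables and components. -/
def permCoeff (σ : Equiv.Perm (Fin 3)) (b : Fin 3 → Fin 3 → Fin 3 → ℂ) :
    Fin 3 → Fin 3 → Fin 3 → ℂ := fun i j k => b (σ i) (σ j) (σ k)

theorem quadMap_permCoeff (σ : Equiv.Perm (Fin 3)) (b : Fin 3 → Fin 3 → Fin 3 → ℂ)
    (w : Fin 3 → ℂ) : quadMap (permCoeff σ b) (w ∘ σ) = quadMap b w ∘ σ := by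
  ext k
  simp only [quadMap, permCoeff, Function.comp]
  rw [Equiv.sum_comp σ fun i => ∑ j, b i (σ j) (σ k) * (w i * w (σ j))]
  exact Finset.sum_congr rfl fun i _ =>
    Equiv.sum_comp σ fun j => b i j (σ k) * (w i * w j)

theorem quadJacobian_permCoeff (σ : Equiv.Perm (Fin 3)) (b : Fin 3 → Fin 3 → Fin 3 → ℂ)
    (w : Fin 3 → ℂ) :
    quadJacobian (permCoeff σ b) (w ∘ σ) = (quadJacobian b w).submatrix σ σ := by
  ext k l
  simp only [quadJacobian, permCoeff, Function.comp, Matrix.of_apply, Matrix.submatrix_apply]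
  rw [Equiv.sum_comp σ fun i => b i (σ l) (σ k) * w i]

theorem quadMap_smul (b : Fin 3 → Fin 3 → Fin 3 → ℂ) (r : ℂ) (w : Fin 3 → ℂ) :
    quadMap b (r • w) = r ^ 2 • quadMap b w := by
  ext k
  simp only [quadMap, Pi.smul_apply, smul_eq_mul, Finset.mul_sum]
  exact Finset.sum_congr rfl fun _ _ => Finset.sum_congr rfl fun _ _ => by ring

theorem quadJacobian_smul (b : Fin 3 → Fin 3 → Fin 3 → ℂ) (r : ℂ) (w : Fin 3 → ℂ) :
    quadJacobian b (r • w) = r • quadJacobian b w := by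
  ext k l
  simp only [quadJacobian, Matrix.of_apply, Matrix.smul_apply, Pi.smul_apply, smul_eq_mul,
    Finset.mul_sum]
  exact Finset.sum_congr rfl fun _ _ => by ring

/-- A nonzero coordinate of w is moved to the first place by a transposition and scaled to 1. The
nonzero square coefficient ensures that the field has degree exactly 2. -/
theorem propertyE_symField {b : Fin 3 → Fin 3 → Fin 3 → ℂ} (hb : ∀ i j k, b i j k = b j i k)
    (hne : ∃ i k, b i i k ≠ 0)
    (H : ∀ (σ : Equiv.Perm (Fin 3)) (s t μ : ℂ),
      quadMap (permCoeff σ b) ![1, s, t] = μ • ![1, s, t] →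
      GoodAt (quadJacobian (permCoeff σ b) ![1, s, t]) μ) : PropertyE (symField b) := by
  refine propertyE_of_goodAt (isHomogeneous_symField b)
    (vfDegree_eq_two (isHomogeneous_symField b) ?_) fun w hw μ hst => ?_
  · obtain ⟨i, k, hik⟩ := hne
    refine ⟨k, fun h0 => hik ?_⟩
    have := congrArg (eval (Pi.single i 1)) h0
    rw [eval_symField] at this
    simpa [quadMap, Pi.single_apply] using this
  · obtain ⟨i, hi⟩ := Function.ne_iff.1 hw
    replace hi : w i ≠ 0 := hi
    have hst' : quadMap b w = μ • w := funext fun k => by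
      rw [← eval_symField, hst]; rfl
    rw [vfJacobian_symField hb]
    set σ := Equiv.swap 0 i
    set r := (w i)⁻¹ with hr
    have hr0 : r ≠ 0 := inv_ne_zero hi
    have hw1 : (r • w) ∘ σ = ![1, r * w (σ 1), r * w (σ 2)] := by
      ext k
      fin_cases k
      · simp [σ, hr, hi]
      · rfl
      · rfl
    refine GoodAt.of_smul hr0 ?_
    refine GoodAt.of_submatrix σ ?_
    rw [← quadJacobian_smul, ← quadJacobian_permCoeff, hw1]
    refine H σ _ _ _ ?_
    rw [← hw1, quadMap_permCoeff, quadMap_smul, hst']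
    ext k
    simp
    ring

/-! ### Almost all quadratic fields: part (b) -/

/-- The symmetric coefficients of the quadratic vector field with coefficients `β`. -/
noncomputable def symCoeff (β : QuadIndex → ℂ) : Fin 3 → Fin 3 → Fin 3 → ℂ := fun i j k =>
  if h : i < j then β (⟨(i, j), h.le⟩, k) / 2
  else if h' : j < i then β (⟨(j, i), h'.le⟩, k) / 2
  else β (⟨(i, i), le_rfl⟩, k)

theorem symCoeff_symm (β : QuadIndex → ℂ) (i j k : Fin 3) :
    symCoeff β i j k = symCoeff β j i k := by
  rcases lt_trichotomy i j with h | rfl | h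
  · simp [symCoeff, h, h.not_gt]
  · rfl
  · simp [symCoeff, h, h.not_gt]

theorem symCoeff_of_lt (β : QuadIndex → ℂ) {i j : Fin 3} (h : i < j) (k : Fin 3) :
    symCoeff β i j k = β (⟨(i, j), h.le⟩, k) / 2 := by simp [symCoeff, h]

theorem symCoeff_self (β : QuadIndex → ℂ) (i k : Fin 3) :
    symCoeff β i i k = β (⟨(i, i), le_rfl⟩, k) := by simp [symCoeff]

theorem sum_le_pairs {M : Type*} [AddCommMonoid M] (f : {q : Fin 3 × Fin 3 // q.1 ≤ q.2} → M) :
    ∑ q, f q = f ⟨(0, 0), by decide⟩ + f ⟨(0, 1), by decide⟩ + f ⟨(0, 2), by decide⟩ +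
      f ⟨(1, 1), by decide⟩ + f ⟨(1, 2), by decide⟩ + f ⟨(2, 2), by decide⟩ := by
  have : (Finset.univ : Finset {q : Fin 3 × Fin 3 // q.1 ≤ q.2}) =
      {⟨(0, 0), by decide⟩, ⟨(0, 1), by decide⟩, ⟨(0, 2), by decide⟩,
        ⟨(1, 1), by decide⟩, ⟨(1, 2), by decide⟩, ⟨(2, 2), by decide⟩} := by decide
  rw [this]
  rw [Finset.sum_insert (by decide), Finset.sum_insert (by decide), Finset.sum_insert (by decide),
    Finset.sum_insert (by decide), Finset.sum_insert (by decide), Finset.sum_singleton]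
  simp only [add_assoc]

theorem quadField_eq_symField (β : QuadIndex → ℂ) : quadField β = symField (symCoeff β) := by
  ext1 k
  rw [quadField, sum_le_pairs, symField]
  have h2 : ∀ z : ℂ, (C z : MvPolynomial (Fin 3) ℂ) = 2 * C (z / 2) := fun z => by
    rw [show (2 : MvPolynomial (Fin 3) ℂ) = C 2 from (map_ofNat C 2).symm, ← C_mul]
    congr 1; ring
  simp only [Fin.sum_univ_three, symCoeff_self, symCoeff_symm β 1 0, symCoeff_symm β 2 0,
    symCoeff_symm β 2 1, symCoeff_of_lt β (show (0 : Fin 3) < 1 by decide),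
    symCoeff_of_lt β (show (0 : Fin 3) < 2 by decide),
    symCoeff_of_lt β (show (1 : Fin 3) < 2 by decide),
    h2 (β (⟨(0, 1), _⟩, k)), h2 (β (⟨(0, 2), _⟩, k)), h2 (β (⟨(1, 2), _⟩, k))]
  ring

theorem forall_coeff_mem {β : QuadIndex → ℂ} {F : Subfield ℂ}
    (h : ∀ i j k, symCoeff β i j k ∈ F) : ∀ q, β q ∈ F := by
  rintro ⟨⟨⟨i, j⟩, hij⟩, k⟩
  replace hij : i ≤ j := hij
  rcases hij.lt_or_eq with hlt | rfl
  · have := mul_mem (h i j k) (two_mem F)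
    rwa [symCoeff_of_lt β hlt, div_mul_cancel₀ _ two_ne_zero] at this
  · exact symCoeff_self β i k ▸ h i i k

theorem forall_mem_permCoeff {σ : Equiv.Perm (Fin 3)} {b : Fin 3 → Fin 3 → Fin 3 → ℂ}
    {F : Subfield ℂ} (h : ∀ i j k, permCoeff σ b i j k ∈ F) (i j k : Fin 3) : b i j k ∈ F := by
  have := h (σ.symm i) (σ.symm j) (σ.symm k)
  simpa [permCoeff] using this

theorem card_quadIndex : Fintype.card QuadIndex = 18 := by
  rw [Fintype.card_prod, Fintype.card_fin, Fintype.card_eq_sum_ones, sum_le_pairs]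
  norm_num

theorem propertyE_quadField {β : QuadIndex → ℂ} (hβ : AlgebraicIndependent ℚ β) :
    PropertyE (quadField β) := by
  rw [quadField_eq_symField]
  refine propertyE_symField (symCoeff_symm β) ⟨0, 0, ?_⟩ fun σ s t μ hst => ?_
  · rw [symCoeff_self]; exact hβ.ne_zero _
  · exact goodAt_of_generic card_quadIndex hβ (fun i j k => symCoeff_symm β (σ i) (σ j) (σ k))
      (fun F hF => forall_coeff_mem (forall_mem_permCoeff (σ := σ) hF)) hst

theorem volume_not_propertyE_quadField :
    volume {β : QuadIndex → ℂ | ¬ PropertyE (quadField β)} = 0 :=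
  measure_mono_null (fun _ h h' => h (propertyE_quadField h'))
    (volume_not_algebraicIndependent QuadIndex)

/-! ### Algebraic independence of the mixed coefficients -/

theorem exists_clear_denominators {σ τ : Type*} (d : MvPolynomial σ ℚ) (a : τ → MvPolynomial σ ℚ)
    (P : MvPolynomial τ ℚ) : ∃ (Q : MvPolynomial σ ℚ) (n : ℕ), ∀ (g : σ → ℂ) (c : τ → ℂ),
      (∀ q, aeval g d * c q = aeval g (a q)) → aeval g Q = aeval g d ^ n * aeval c P := by
  induction P using MvPolynomial.induction_on with
  | C r => exact ⟨C r, 0, fun g c _ => by simp⟩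
  | add P₁ P₂ h₁ h₂ =>
    obtain ⟨Q₁, n₁, h₁⟩ := h₁
    obtain ⟨Q₂, n₂, h₂⟩ := h₂
    refine ⟨d ^ n₂ * Q₁ + d ^ n₁ * Q₂, n₁ + n₂, fun g c h => ?_⟩
    rw [map_add, map_mul, map_mul, map_pow, map_pow, h₁ g c h, h₂ g c h, map_add]
    ring
  | mul_X P q h₁ =>
    obtain ⟨Q, n, h₁⟩ := h₁
    refine ⟨Q * a q, n + 1, fun g c h => ?_⟩
    rw [map_mul, map_mul, aeval_X, h₁ g c h, ← h q]
    ring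

theorem eval_smul_of_isHomogeneous {ι : Type*} {P : MvPolynomial ι ℂ} {n : ℕ}
    (hP : P.IsHomogeneous n) (r : ℂ) (x : ι → ℂ) : eval (r • x) P = r ^ n * eval x P := by
  rw [eval_eq, eval_eq, Finset.mul_sum]
  refine Finset.sum_congr rfl fun m hm => ?_
  have : ∑ i ∈ m.support, m i = n := by
    simp [← hP (mem_support_iff.1 hm), Finsupp.weight_apply, Finsupp.sum]
  simp only [Pi.smul_apply, smul_eq_mul, mul_pow, Finset.prod_mul_distrib,
    Finset.prod_pow_eq_pow_sum, this]
  ring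

/-- Take x outside the zero set of the lowest nonzero homogeneous component of `P`, of degree d₀.
Then P(ε u(ε)) / ε^d₀ tends to the value of that component at x. -/
theorem exists_forall_not_eventually_eval_eq_zero {ι : Type*} [Finite ι] {P : MvPolynomial ι ℂ}
    (hP : P ≠ 0) : ∃ x : ι → ℂ, ∀ u : ℂ → ι → ℂ, Tendsto u (𝓝[≠] 0) (𝓝 x) →
      ¬ ∀ᶠ ε in 𝓝[≠] 0, eval (ε • u ε) P = 0 := by
  classical
  have hex : ∃ d, homogeneousComponent d P ≠ 0 := by
    by_contra! h
    exact hP (by rw [← sum_homogeneousComponent P]; exact Finset.sum_eq_zero fun d _ => h d)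
  obtain ⟨d₀, hd₀, hmin⟩ : ∃ d₀, homogeneousComponent d₀ P ≠ 0 ∧
      ∀ d < d₀, homogeneousComponent d P = 0 :=
    ⟨Nat.find hex, Nat.find_spec hex, fun d hd => not_not.1 (Nat.find_min hex hd)⟩
  obtain ⟨x, hx⟩ : ∃ x, eval x (homogeneousComponent d₀ P) ≠ 0 := by
    by_contra! h
    exact hd₀ (MvPolynomial.funext fun x => by rw [h, map_zero])
  refine ⟨x, fun u hu hev => hx ?_⟩
  obtain ⟨R, hRdef⟩ : ∃ R : ℂ → (ι → ℂ) → ℂ, ∀ ε y, R ε y =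
      ∑ d ∈ Finset.range (P.totalDegree + 1),
        ε ^ (d - d₀) * eval y (homogeneousComponent d P) := ⟨_, fun _ _ => rfl⟩
  have hR : ∀ ε y, eval (ε • y) P = ε ^ d₀ * R ε y := by
    intro ε y
    conv_lhs => rw [← sum_homogeneousComponent P, map_sum]
    rw [hRdef, Finset.mul_sum]
    refine Finset.sum_congr rfl fun d _ => ?_
    by_cases hd : d < d₀
    · simp [hmin d hd]
    · rw [← mul_assoc, ← pow_add, Nat.add_sub_cancel' (not_lt.1 hd)]
      exact eval_smul_of_isHomogeneous (homogeneousComponent_isHomogeneous d P) ε y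
  have hcont : Continuous fun z : ℂ × (ι → ℂ) => R z.1 z.2 := by
    simp only [hRdef]
    refine continuous_finsetSum _ fun d _ => ?_
    exact (continuous_fst.pow _).mul ((MvPolynomial.continuous_eval _).comp continuous_snd)
  have hlim : Tendsto (fun ε => R ε (u ε)) (𝓝[≠] 0) (𝓝 (R 0 x)) :=
    (hcont.tendsto (0, x)).comp
      ((tendsto_nhdsWithin_of_tendsto_nhds tendsto_id).prodMk_nhds hu)
  have hzero : R 0 x = 0 := by
    have : Tendsto (fun ε => R ε (u ε)) (𝓝[≠] 0) (𝓝 0) := by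
      refine tendsto_const_nhds.congr' ?_
      filter_upwards [hev, self_mem_nhdsWithin] with ε h hε
      rw [hR] at h
      exact ((mul_eq_zero.1 h).resolve_left (pow_ne_zero _ hε)).symm
    exact tendsto_nhds_unique hlim this
  rw [← hzero, hRdef]
  have hle : d₀ ∈ Finset.range (P.totalDegree + 1) := by
    rw [Finset.mem_range, Nat.lt_succ_iff]
    by_contra! h
    exact hd₀ (homogeneousComponent_eq_zero _ _ h)
  rw [Finset.sum_eq_single_of_mem d₀ hle]
  · simp
  · intro d _ hd
    rcases lt_or_gt_of_ne hd with h | h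
    · simp [hmin d h]
    · rw [zero_pow (Nat.sub_ne_zero_of_lt h), zero_mul]

/-- The generic version of `distinguishedMatrix`. -/
noncomputable def genericMatrix : Matrix (Fin 3) (Fin 3) (MvPolynomial (Fin 3 × Fin 3) ℚ) :=
  Matrix.of fun i j => X (i, j) * X (i, j + 1)

/-- The generic right hand side of the linear system for the mixed coefficients. -/
noncomputable def genericRhs : Matrix (Fin 3) (Fin 3) (MvPolynomial (Fin 3 × Fin 3) ℚ) :=
  Matrix.of fun i k => X (i, k) - X (i, k) ^ 2

/-- The right hand side of the linear system for the mixed coefficients. -/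
def distinguishedRhs (γ : Fin 3 → Fin 3 → ℂ) : Matrix (Fin 3) (Fin 3) ℂ :=
  Matrix.of fun i k => γ i k - γ i k ^ 2

theorem map_genericMatrix (γ : Fin 3 → Fin 3 → ℂ) :
    (aeval fun q : Fin 3 × Fin 3 => γ q.1 q.2).mapMatrix genericMatrix =
      distinguishedMatrix γ := by
  ext i j
  simp [genericMatrix, distinguishedMatrix]

theorem map_genericRhs (γ : Fin 3 → Fin 3 → ℂ) :
    (aeval fun q : Fin 3 × Fin 3 => γ q.1 q.2).mapMatrix genericRhs = distinguishedRhs γ := by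
  ext i j
  simp [genericRhs, distinguishedRhs]

theorem aeval_det_genericMatrix (γ : Fin 3 → Fin 3 → ℂ) :
    aeval (fun q : Fin 3 × Fin 3 => γ q.1 q.2) genericMatrix.det =
      (distinguishedMatrix γ).det := by
  rw [AlgHom.map_det, map_genericMatrix]

/-- Base point at which the mixed coefficients vanish. -/
def basePoint : Fin 3 → Fin 3 → ℂ := fun i k => if k = i + 2 then 0 else 1

theorem distinguishedMatrix_basePoint : distinguishedMatrix basePoint = 1 := by
  ext i j
  fin_cases i <;> fin_cases j <;> simp [distinguishedMatrix, basePoint]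

/-- The determinant is a nonzero polynomial in γ, since it equals 1 at `basePoint`. -/
theorem det_distinguishedMatrix_ne_zero {γ : Fin 3 → Fin 3 → ℂ}
    (hγ : AlgebraicIndependent ℚ fun q : Fin 3 × Fin 3 => γ q.1 q.2) :
    (distinguishedMatrix γ).det ≠ 0 := by
  rw [← aeval_det_genericMatrix]
  intro h
  have h0 := aeval_det_genericMatrix basePoint
  rw [algebraicIndependent_iff.1 hγ _ h, distinguishedMatrix_basePoint] at h0
  simp at h0

/-- By Cramer's rule, a relation P(c) = 0 becomes a polynomial relation for γ, which must be
trivial. Hence P vanishes on the solutions of the system for all parameters with nonzero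
determinant, in particular along curves of solutions ε u(ε) with u(ε) → x for the chosen x, so P =
0. -/
theorem algebraicIndependent_mixed {γ : Fin 3 → Fin 3 → ℂ}
    (hγ : AlgebraicIndependent ℚ fun q : Fin 3 × Fin 3 => γ q.1 q.2)
    {c : Matrix (Fin 3) (Fin 3) ℂ} (hc : distinguishedMatrix γ * c = distinguishedRhs γ) :
    AlgebraicIndependent ℚ fun q : Fin 3 × Fin 3 => c q.1 q.2 := by
  rw [algebraicIndependent_iff]
  intro P hP
  by_contra hP0
  obtain ⟨Q, n, hQ⟩ := exists_clear_denominators genericMatrix.det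
    (fun q : Fin 3 × Fin 3 => (genericMatrix.adjugate * genericRhs) q.1 q.2) P
  have hrel : ∀ (g : Fin 3 → Fin 3 → ℂ) (e : Matrix (Fin 3) (Fin 3) ℂ),
      distinguishedMatrix g * e = distinguishedRhs g →
      aeval (fun q : Fin 3 × Fin 3 => g q.1 q.2) Q =
        (distinguishedMatrix g).det ^ n * aeval (fun q : Fin 3 × Fin 3 => e q.1 q.2) P := by
    intro g e he
    rw [← aeval_det_genericMatrix]
    refine hQ _ _ fun q => ?_
    rw [aeval_det_genericMatrix]
    have h1 : (distinguishedMatrix g).adjugate * (distinguishedMatrix g * e) =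
        (distinguishedMatrix g).det • e := by
      rw [← mul_assoc, Matrix.adjugate_mul, smul_mul_assoc, one_mul]
    have h2 : (aeval fun q : Fin 3 × Fin 3 => g q.1 q.2).mapMatrix
        (genericMatrix.adjugate * genericRhs) = (distinguishedMatrix g).det • e := by
      rw [map_mul, AlgHom.map_adjugate, map_genericMatrix, map_genericRhs, ← he, h1]
    exact (congrFun (congrFun h2 q.1) q.2).symm
  have hQ0 : Q = 0 := algebraicIndependent_iff.1 hγ Q (by rw [hrel γ c hc, hP, mul_zero])
  have hvanish : ∀ (g : Fin 3 → Fin 3 → ℂ) (e : Matrix (Fin 3) (Fin 3) ℂ),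
      (distinguishedMatrix g).det ≠ 0 → distinguishedMatrix g * e = distinguishedRhs g →
      aeval (fun q : Fin 3 × Fin 3 => e q.1 q.2) P = 0 := by
    intro g e hg he
    have := hrel g e he
    rw [hQ0, map_zero] at this
    exact (mul_eq_zero.1 this.symm).resolve_left (pow_ne_zero _ hg)
  have hPC : map (algebraMap ℚ ℂ) P ≠ 0 := by
    rwa [Ne, map_eq_zero_iff _ (map_injective _ (algebraMap ℚ ℂ).injective)]
  obtain ⟨x, hx⟩ := exists_forall_not_eventually_eval_eq_zero hPC
  -- The derivative of z - z² at a base coordinate is 1 - 2z = ±1. The same factor in the direction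
  -- makes the right-hand side exactly ε (x - ε x²).
  let g : ℂ → Fin 3 → Fin 3 → ℂ := fun ε i k =>
    basePoint i k + ε * ((1 - 2 * basePoint i k) * x (i, k))
  let r : ℂ → Matrix (Fin 3) (Fin 3) ℂ := fun ε => Matrix.of fun i k => x (i, k) - ε * x (i, k) ^ 2
  have hM : Continuous fun ε => distinguishedMatrix (g ε) := by
    refine continuous_matrix fun i j => ?_
    simp only [distinguishedMatrix, Matrix.of_apply, g]
    fun_prop
  have hr : Continuous r := by
    refine continuous_matrix fun i j => ?_
    simp only [Matrix.of_apply, r]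
    fun_prop
  have hg0 : distinguishedMatrix (g 0) = 1 := by
    rw [← distinguishedMatrix_basePoint]
    simp [g]
  have hrhs : ∀ ε, distinguishedRhs (g ε) = ε • r ε := by
    intro ε
    ext i k
    have hb : basePoint i k ^ 2 = basePoint i k := by
      simp only [basePoint]; split_ifs <;> norm_num
    simp only [distinguishedRhs, g, r, Matrix.of_apply, Matrix.smul_apply, smul_eq_mul]
    linear_combination (4 * ε * x (i, k) - 4 * ε ^ 2 * x (i, k) ^ 2 - 1) * hb
  have hdet : Continuous fun ε => (distinguishedMatrix (g ε)).det := hM.matrix_det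
  have hev : ∀ᶠ ε in 𝓝 (0 : ℂ), (distinguishedMatrix (g ε)).det ≠ 0 :=
    hdet.continuousAt.eventually_ne (by rw [hg0]; simp)
  let u : ℂ → Matrix (Fin 3) (Fin 3) ℂ := fun ε =>
    (distinguishedMatrix (g ε)).det⁻¹ • ((distinguishedMatrix (g ε)).adjugate * r ε)
  have hu : ContinuousAt u 0 := by
    refine ContinuousAt.smul (hdet.continuousAt.inv₀ (by rw [hg0]; simp)) ?_
    exact (hM.matrix_adjugate.matrix_mul hr).continuousAt
  have hu0 : u 0 = Matrix.of fun i k => x (i, k) := by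
    simp only [u, hg0, r]
    simp
  refine hx (fun ε q => u ε q.1 q.2) ?_ ?_
  · refine tendsto_pi_nhds.2 fun q => ?_
    have h1 : Tendsto u (𝓝[≠] 0) (𝓝 (u 0)) := tendsto_nhdsWithin_of_tendsto_nhds hu
    rw [hu0] at h1
    exact (tendsto_pi_nhds.1 (tendsto_pi_nhds.1 h1 q.1)) q.2
  · filter_upwards [nhdsWithin_le_nhds hev] with ε hε
    have := hvanish (g ε) (ε • u ε) hε (by
      rw [hrhs, Matrix.mul_smul, Matrix.mul_smul, ← mul_assoc, Matrix.mul_adjugate, smul_mul_assoc,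
        one_mul, inv_smul_smul₀ hε])
    rw [aeval_def, ← eval_map] at this
    exact this

/-! ### Distinguished fields: part (a) -/

/-- The symmetric coefficients of the vector field fixing the standard basis vectors, with mixed
coefficients `c`, where `c j k` belongs to `x j * x (j + 1)` in component `k`. -/
noncomputable def mixedCoeff (c : Matrix (Fin 3) (Fin 3) ℂ) : Fin 3 → Fin 3 → Fin 3 → ℂ :=
  fun i j k => if i = j then (1 : Matrix (Fin 3) (Fin 3) ℂ) i k else c (1 - (i + j)) k / 2

theorem mixedCoeff_symm (c : Matrix (Fin 3) (Fin 3) ℂ) (i j k : Fin 3) :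
    mixedCoeff c i j k = mixedCoeff c j i k := by
  by_cases h : i = j
  · rw [h]
  · simp [mixedCoeff, h, Ne.symm h, add_comm i j]

theorem mixedCoeff_self (c : Matrix (Fin 3) (Fin 3) ℂ) (i k : Fin 3) :
    mixedCoeff c i i k = (1 : Matrix (Fin 3) (Fin 3) ℂ) i k := by simp [mixedCoeff]

/-- In `Fin 3`, 1 - (j + (j + 1)) = -2j = j, so the index in `mixedCoeff` picks the right row for
either order of the pair. -/
theorem mixedCoeff_add_one (c : Matrix (Fin 3) (Fin 3) ℂ) (j k : Fin 3) :
    mixedCoeff c j (j + 1) k = c j k / 2 := by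
  fin_cases j <;> simp [mixedCoeff]

theorem propertyE_mixed {c : Matrix (Fin 3) (Fin 3) ℂ}
    (hc : AlgebraicIndependent ℚ fun q : Fin 3 × Fin 3 => c q.1 q.2) :
    PropertyE (symField (mixedCoeff c)) := by
  refine propertyE_symField (mixedCoeff_symm c) ⟨0, 0, by simp [mixedCoeff]⟩
    fun σ s t μ hst => ?_
  refine goodAt_of_generic_of_basis_idempotent (b := permCoeff σ (mixedCoeff c)) (by simp) hc
    (fun i j k => mixedCoeff_symm c (σ i) (σ j) (σ k)) (fun i k => ?_) (fun F hF q => ?_) hst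
  · change mixedCoeff c (σ i) (σ i) (σ k) = _
    simp [mixedCoeff_self, Matrix.one_apply]
  · have := mul_mem (forall_mem_permCoeff (σ := σ) hF q.1 (q.1 + 1) q.2) (two_mem F)
    rwa [mixedCoeff_add_one, div_mul_cancel₀ _ two_ne_zero] at this

theorem exists_symField_eq {p : Fin 3 → MvPolynomial (Fin 3) ℂ}
    (hp : ∀ k, (p k).IsHomogeneous 2) :
    ∃ b : Fin 3 → Fin 3 → Fin 3 → ℂ, (∀ i j k, b i j k = b j i k) ∧ p = symField b := by
  have hC : ∀ i j k, ∃ z : ℂ, pderiv j (pderiv i (p k)) = C z := fun i j k => by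
    have := (hp k).pderiv (i := i) |>.pderiv (i := j)
    exact ⟨_, totalDegree_eq_zero_iff_eq_C.1 ((totalDegree_zero_iff_isHomogeneous _).2 this)⟩
  choose z hz using hC
  have h2 : ∀ k, 2 * (p k) = ∑ i, ∑ j, C (z i j k) * (X i * X j) := fun k => by
    have e := (hp k).sum_X_mul_pderiv
    rw [nsmul_eq_mul, Nat.cast_ofNat] at e
    rw [← e]
    refine Finset.sum_congr rfl fun i _ => ?_
    have e' := ((hp k).pderiv (i := i)).sum_X_mul_pderiv
    rw [Nat.add_one_sub_one, one_smul] at e'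
    rw [← e', Finset.mul_sum]
    exact Finset.sum_congr rfl fun j _ => by rw [hz]; ring
  have h2' : ∀ k, 2 * (p k) = ∑ i, ∑ j, C (z j i k) * (X i * X j) := fun k => by
    rw [h2, Finset.sum_comm]
    exact Finset.sum_congr rfl fun i _ => Finset.sum_congr rfl fun j _ => by ring
  -- Euler's identity applied twice gives 2p as a quadratic form in the second partials. Averaging
  -- with the transpose makes the coefficients symmetric without commuting the derivatives, hence
  -- the 4.
  refine ⟨fun i j k => (z i j k + z j i k) / 4, fun i j k => by ring, _root_.funext fun k => ?_⟩
  have h4 : (4 : MvPolynomial (Fin 3) ℂ) = C 4 := (map_ofNat C 4).symm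
  have h4' : (4 : MvPolynomial (Fin 3) ℂ) ≠ 0 := by rw [h4]; simp
  refine mul_left_cancel₀ h4' ?_
  have : 4 * p k = 2 * p k + 2 * p k := by ring
  rw [this]
  nth_rewrite 1 [h2]
  rw [h2', symField, ← Finset.sum_add_distrib, Finset.mul_sum]
  refine Finset.sum_congr rfl fun i _ => ?_
  rw [← Finset.sum_add_distrib, Finset.mul_sum]
  refine Finset.sum_congr rfl fun j _ => ?_
  have hz4 : C (z i j k) + C (z j i k) =
      (4 : MvPolynomial (Fin 3) ℂ) * C ((z i j k + z j i k) / 4) := by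
    rw [h4, ← C_mul, ← C_add]
    congr 1
    ring
  linear_combination (X i * X j) * hz4

theorem quadMap_single (b : Fin 3 → Fin 3 → Fin 3 → ℂ) (i k : Fin 3) :
    quadMap b (Pi.single i 1) k = b i i k := by
  simp [quadMap, Pi.single_apply]

theorem quadMap_mixedCoeff (c : Matrix (Fin 3) (Fin 3) ℂ) (γ : Fin 3 → Fin 3 → ℂ)
    (i k : Fin 3) :
    quadMap (mixedCoeff c) (γ i) k = γ i k ^ 2 + (distinguishedMatrix γ * c) i k := by
  have e := fun j => mixedCoeff_add_one c j k
  have e0 : mixedCoeff c 0 1 k = c 0 k / 2 := e 0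
  have e1 : mixedCoeff c 1 2 k = c 1 k / 2 := e 1
  have e2 : mixedCoeff c 2 0 k = c 2 k / 2 := e 2
  have hone : (1 : Matrix (Fin 3) (Fin 3) ℂ) 0 k * (γ i 0 * γ i 0) +
      (1 : Matrix (Fin 3) (Fin 3) ℂ) 1 k * (γ i 1 * γ i 1) +
      (1 : Matrix (Fin 3) (Fin 3) ℂ) 2 k * (γ i 2 * γ i 2) = γ i k ^ 2 := by
    have hk : k = 0 ∨ k = 1 ∨ k = 2 := by fin_cases k <;> simp
    rcases hk with rfl | rfl | rfl <;> simp [sq]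
  have a1 : (1 : Fin 3) + 1 = 2 := rfl
  have a2 : (2 : Fin 3) + 1 = 0 := rfl
  simp only [quadMap, Matrix.mul_apply, distinguishedMatrix, Matrix.of_apply, Fin.sum_univ_three,
    mixedCoeff_self, mixedCoeff_symm c 1 0, mixedCoeff_symm c 2 1, mixedCoeff_symm c 0 2, e0, e1,
    e2, zero_add, a1, a2]
  linear_combination hone

theorem eq_mixedCoeff {b : Fin 3 → Fin 3 → Fin 3 → ℂ} (hb : ∀ i j k, b i j k = b j i k)
    (hdiag : ∀ i k, b i i k = (1 : Matrix (Fin 3) (Fin 3) ℂ) i k) :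
    b = mixedCoeff (Matrix.of fun j k => 2 * b j (j + 1) k) := by
  ext i j k
  by_cases h : i = j
  · rw [← h, hdiag, mixedCoeff_self]
  · rw [mixedCoeff, if_neg h, Matrix.of_apply, mul_div_cancel_left₀ _ two_ne_zero]
    revert h
    fin_cases i <;> fin_cases j <;> intro h
    exacts [absurd rfl h, rfl, hb 0 2 k, hb 1 0 k, absurd rfl h, rfl, rfl, hb 2 1 k, absurd rfl h]

/-- The basis idempotents fix the square coefficients; by `quadMap_mixedCoeff`, the other three
idempotents amount to the linear system for the mixed ones. -/
theorem IsDistinguished.exists_mixed {γ : Fin 3 → Fin 3 → ℂ} {p : Fin 3 → MvPolynomial (Fin 3) ℂ}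
    (h : IsDistinguished γ p) : ∃ c : Matrix (Fin 3) (Fin 3) ℂ, p = symField (mixedCoeff c) ∧
      distinguishedMatrix γ * c = distinguishedRhs γ := by
  obtain ⟨b, hb, rfl⟩ := exists_symField_eq h.homogeneous
  have hdiag : ∀ i k, b i i k = (1 : Matrix (Fin 3) (Fin 3) ℂ) i k := fun i k => by
    rw [← quadMap_single b, ← eval_symField, (h.basis_idempotent i).1, Matrix.one_apply,
      Pi.single_apply]
    simp [eq_comm]
  rw [eq_mixedCoeff hb hdiag] at h ⊢
  refine ⟨_, rfl, ?_⟩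
  ext i k
  have := (h.further_idempotent i).1 k
  rw [eval_symField, quadMap_mixedCoeff] at this
  rw [distinguishedRhs, Matrix.of_apply]
  linear_combination this

theorem isDistinguished_mixed {γ : Fin 3 → Fin 3 → ℂ} (hγ : ∀ i, γ i ≠ 0)
    (hdet : (distinguishedMatrix γ).det ≠ 0) {c : Matrix (Fin 3) (Fin 3) ℂ}
    (hc : distinguishedMatrix γ * c = distinguishedRhs γ) :
    IsDistinguished γ (symField (mixedCoeff c)) where
  homogeneous := isHomogeneous_symField _
  basis_idempotent i := by
    refine ⟨fun k => ?_, fun h => ?_⟩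
    · rw [eval_symField, quadMap_single, mixedCoeff_self, Matrix.one_apply, Pi.single_apply]
      simp [eq_comm]
    · simpa using congrFun h i
  further_idempotent i := by
    refine ⟨fun k => ?_, hγ i⟩
    rw [eval_symField, quadMap_mixedCoeff, hc, distinguishedRhs, Matrix.of_apply]
    ring
  isUnit_matrix := (Matrix.isUnit_iff_isUnit_det _).2 (isUnit_iff_ne_zero.2 hdet)

theorem mainTheorem7 :
    (∀ γ : Fin 3 → Fin 3 → ℂ,
      AlgebraicIndependent ℚ (fun q : Fin 3 × Fin 3 => γ q.1 q.2) →
        (∃! p : Fin 3 → MvPolynomial (Fin 3) ℂ, IsDistinguished γ p) ∧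
        ∀ p : Fin 3 → MvPolynomial (Fin 3) ℂ, IsDistinguished γ p → PropertyE p) ∧
    MeasureTheory.volume {β : QuadIndex → ℂ | ¬ PropertyE (quadField β)} = 0 := by
  refine ⟨fun γ hγ => ?_, volume_not_propertyE_quadField⟩
  have hdet := det_distinguishedMatrix_ne_zero hγ
  have hunit : IsUnit (distinguishedMatrix γ).det := isUnit_iff_ne_zero.2 hdet
  refine ⟨⟨symField (mixedCoeff ((distinguishedMatrix γ)⁻¹ * distinguishedRhs γ)), ?_, ?_⟩, ?_⟩
  · refine isDistinguished_mixed (fun i h => hγ.ne_zero (i, 0) (congrFun h 0)) hdet ?_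
    rw [← mul_assoc, Matrix.mul_nonsing_inv _ hunit, one_mul]
  · intro p hp
    obtain ⟨c, rfl, hc⟩ := hp.exists_mixed
    rw [← hc, ← mul_assoc, Matrix.nonsing_inv_mul _ hunit, one_mul]
  · intro p hp
    obtain ⟨c, rfl, hc⟩ := hp.exists_mixed
    exact propertyE_mixed (algebraicIndependent_mixed hγ hc)
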